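/- Let $p_0=(0,0)$, $p_1=(1,0)$, $p_2=(1/2,\sqrt3/2)$ in $\mathbb{R}^2$, let $f_i(x)=(x+p_i)/2$ for $i=0,1,2$, and let $K$ be the Sierpiński gasket, i.e. the unique non-empty compact set with $K=f_0(K)\cup f_1(K)\cup f_2(K)$. Let $I=[0,1]$, identified with the segment $[p_0,p_1]\subseteq K$ via $t\mapsto(t,0)$. Regard $K$ and $I$ as metric measure spaces with the Euclidean metrics and the normalized (total mass one) Hausdorff measures of dimensions $\alpha_1=\log 3/\log 2$ and $\alpha_2=1$, respectively, and let $\beta_1^*=\log5/\log2$. For a metric measure space $(M,d,\mu)$ and $\alpha,\beta>0$ let $$B^{2,2}_{\alpha,\beta}(M)=\Big\{u\in L^2(M;\mu):\sum_{n=0}^\infty 2^{(\alpha+\beta)n}\int_M\int_{d(x,y)<2^{-n}}(u(x)-u(y))^2\,\mu(dy)\,\mu(dx)<\infty\Big\}.$$ Let $\beta_1\in(\alpha_1,\beta_1^*)$ and let $\beta_2$ satisfy $\beta_1-\alpha_1=\beta_2-\alpha_2$. Then every $u\in B^{2,2}_{\alpha_1,\beta_1}(K)$ has a unique continuous version $\tilde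 u\in C(K)$, and hence a well-defined trace $\tilde u|_I$ on $I$. The space of all these traces $\tilde u|_I$, $u\in B^{2,2}_{\alpha_1,\beta_1}(K)$, considered as elements of $L^2(I)$, is exactly $B^{2,2}_{\alpha_2,\beta_2}(I)$. That is, each such trace lies in $B^{2,2}_{\alpha_2,\beta_2}(I)$, and each element of $B^{2,2}_{\alpha_2,\beta_2}(I)$ is the trace of some $u\in B^{2,2}_{\alpha_1,\beta_1}(K)$. -/

import Mathlib

open MeasureTheory Set Filter
open scoped ENNReal MeasureTheory

namespace SierpinskiTrace

/-- The Euclidean plane. -/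
abbrev Plane : Type := EuclideanSpace ℝ (Fin 2)

/-- The vertices `p₀ = (0,0)`, `p₁ = (1,0)`, `p₂ = (1/2, √3/2)`. -/
noncomputable def vertex : Fin 3 → Plane :=
  ![!₂[0, 0], !₂[1, 0], !₂[1 / 2, Real.sqrt 3 / 2]]

/-- The contractions `fᵢ(x) = (x + pᵢ)/2`. -/
noncomputable def contraction (i : Fin 3) (x : Plane) : Plane :=
  (1 / 2 : ℝ) • (x + vertex i)

/-- `V₀ = {p₀, p₁, p₂}` and `Vₙ₊₁ = f₀(Vₙ) ∪ f₁(Vₙ) ∪ f₂(Vₙ)`. -/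
noncomputable def level : ℕ → Set Plane
  | 0 => range vertex
  | n + 1 => ⋃ i, contraction i '' level n

/-- The Sierpiński gasket `K`, the closure of `⋃ₙ Vₙ`. By `gasket_existsUnique` below it is the
unique non-empty compact set with `K = f₀(K) ∪ f₁(K) ∪ f₂(K)`. -/
noncomputable def gasket : Set Plane := closure (⋃ n, level n)

theorem continuous_contraction (i : Fin 3) : Continuous (contraction i) := by
  unfold contraction
  fun_prop

theorem dist_contraction (i : Fin 3) (x y : Plane) :
    dist (contraction i x) (contraction i y) = 1 / 2 * dist x y := by
  unfold contraction
  rw [dist_smul₀, dist_add_right]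
  norm_num

theorem contraction_vertex (i : Fin 3) : contraction i (vertex i) = vertex i := by
  unfold contraction
  rw [← two_smul ℝ (vertex i), smul_smul]
  norm_num

theorem norm_vertex_le (i : Fin 3) : ‖vertex i‖ ≤ 1 := by
  have h3 : Real.sqrt 3 ^ 2 = 3 := Real.sq_sqrt (by norm_num)
  rw [← sq_le_one_iff₀ (norm_nonneg _), EuclideanSpace.norm_sq_eq]
  fin_cases i <;> simp [vertex, Fin.sum_univ_two]
  rw [div_pow, h3]
  norm_num

theorem level_subset_closedBall (n : ℕ) : level n ⊆ Metric.closedBall 0 1 := by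
  induction n with
  | zero =>
    rintro _ ⟨i, rfl⟩
    simpa using norm_vertex_le i
  | succ n ih =>
    intro x hx
    simp only [level, mem_iUnion] at hx
    obtain ⟨i, y, hy, rfl⟩ := hx
    have h1 : ‖y‖ ≤ 1 := by simpa using ih hy
    have h2 := norm_vertex_le i
    have h3 := norm_add_le y (vertex i)
    simp only [mem_closedBall_zero_iff, contraction, norm_smul]
    norm_num
    linarith

theorem isCompact_gasket : IsCompact gasket :=
  (isCompact_closedBall (0 : Plane) 1).of_isClosed_subset isClosed_closure
    (closure_minimal (iUnion_subset level_subset_closedBall) Metric.isClosed_closedBall)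

theorem vertex_mem_gasket (i : Fin 3) : vertex i ∈ gasket :=
  subset_closure (mem_iUnion.2 ⟨0, i, rfl⟩)

theorem gasket_eq : gasket = ⋃ i, contraction i '' gasket := by
  have hU : (⋃ n, level n) = ⋃ i, contraction i '' (⋃ n, level n) := by
    apply Subset.antisymm
    · refine iUnion_subset fun n => ?_
      cases n with
      | zero =>
        rintro _ ⟨i, rfl⟩
        exact mem_iUnion.2 ⟨i, vertex i, mem_iUnion.2 ⟨0, i, rfl⟩, contraction_vertex i⟩
      | succ n =>
        exact iUnion_mono fun i => image_mono (subset_iUnion level n)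
    · refine iUnion_subset fun i => ?_
      rintro _ ⟨x, hx, rfl⟩
      obtain ⟨n, hn⟩ := mem_iUnion.1 hx
      exact mem_iUnion.2 ⟨n + 1, mem_iUnion.2 ⟨i, x, hn, rfl⟩⟩
  apply Subset.antisymm
  · refine closure_minimal ?_ (isClosed_iUnion_of_finite fun i =>
      (isCompact_gasket.image (continuous_contraction i)).isClosed)
    conv_lhs => rw [hU]
    exact iUnion_mono fun i => image_mono subset_closure
  · refine iUnion_subset fun i => ?_
    refine (image_closure_subset_closure_image (continuous_contraction i)).trans ?_
    apply closure_mono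
    conv_rhs => rw [hU]
    exact subset_iUnion (fun i => contraction i '' (⋃ n, level n)) i

/-- The gasket is the unique non-empty compact set `K` with `K = f₀(K) ∪ f₁(K) ∪ f₂(K)`. -/
theorem gasket_existsUnique (K : Set Plane) :
    (K.Nonempty ∧ IsCompact K ∧ K = ⋃ i, contraction i '' K) ↔ K = gasket := by
  refine ⟨?_, ?_⟩
  swap
  · rintro rfl
    exact ⟨⟨_, vertex_mem_gasket 0⟩, isCompact_gasket, gasket_eq⟩
  rintro ⟨⟨x₀, hx₀⟩, hK, hself⟩
  have hmap : ∀ i, ∀ x ∈ K, contraction i x ∈ K := fun i x hx => by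
    rw [hself]
    exact mem_iUnion.2 ⟨i, x, hx, rfl⟩
  apply Subset.antisymm
  · obtain ⟨x, hx, hmax⟩ := hK.exists_isMaxOn ⟨x₀, hx₀⟩
      (Metric.continuous_infDist_pt gasket).continuousOn
    have hne : gasket.Nonempty := ⟨_, vertex_mem_gasket 0⟩
    have hle : Metric.infDist x gasket ≤ 1 / 2 * Metric.infDist x gasket := by
      have hx' := hx
      rw [hself] at hx'
      obtain ⟨i, y, hy, rfl⟩ := mem_iUnion.1 hx'
      obtain ⟨z, hz, hyz⟩ := isCompact_gasket.exists_infDist_eq_dist hne y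
      have hz' : contraction i z ∈ gasket := by
        rw [gasket_eq]
        exact mem_iUnion.2 ⟨i, z, hz, rfl⟩
      have h1 := Metric.infDist_le_dist_of_mem (x := contraction i y) hz'
      rw [dist_contraction, ← hyz] at h1
      have h2 : Metric.infDist y gasket ≤ Metric.infDist (contraction i y) gasket := hmax hy
      linarith
    intro y hy
    have h0 : Metric.infDist y gasket ≤ Metric.infDist x gasket := hmax hy
    have h1 : Metric.infDist y gasket = 0 :=
      le_antisymm (by linarith) Metric.infDist_nonneg
    exact (isCompact_gasket.isClosed.mem_iff_infDist_zero hne).2 h1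
  · have hv : ∀ i, vertex i ∈ K := fun i => by
      have hit : ∀ n : ℕ, (contraction i)^[n] x₀ ∈ K := fun n => by
        induction n with
        | zero => exact hx₀
        | succ n ih => rw [Function.iterate_succ_apply']; exact hmap i _ ih
      have hd : ∀ n : ℕ, dist ((contraction i)^[n] x₀) (vertex i)
          = (1 / 2 : ℝ) ^ n * dist x₀ (vertex i) := fun n => by
        induction n with
        | zero => simp
        | succ n ih =>
          rw [Function.iterate_succ_apply']
          conv_lhs => rw [← contraction_vertex i]
          rw [dist_contraction, ih, pow_succ]
          ring
      have ht : Tendsto (fun n : ℕ => (contraction i)^[n] x₀) atTop (nhds (vertex i)) := by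
        rw [tendsto_iff_dist_tendsto_zero]
        simp only [hd]
        simpa using (tendsto_pow_atTop_nhds_zero_of_lt_one (r := (1 / 2 : ℝ))
          (by norm_num) (by norm_num)).mul_const (dist x₀ (vertex i))
      exact hK.isClosed.mem_of_tendsto ht (Eventually.of_forall hit)
    refine closure_minimal (iUnion_subset fun n => ?_) hK.isClosed
    induction n with
    | zero => rintro _ ⟨i, rfl⟩; exact hv i
    | succ n ih =>
      refine iUnion_subset fun i => ?_
      rintro _ ⟨x, hx, rfl⟩
      exact hmap i x (ih hx)

theorem dyadic_mem_level (n k : ℕ) (hk : k ≤ 2 ^ n) :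
    !₂[(k : ℝ) / 2 ^ n, 0] ∈ level n := by
  induction n generalizing k with
  | zero =>
    have : k = 0 ∨ k = 1 := by simp at hk; omega
    rcases this with rfl | rfl
    · exact ⟨0, by simp [vertex]⟩
    · exact ⟨1, by simp [vertex]⟩
  | succ n ih =>
    rcases le_total k (2 ^ n) with h | h
    · refine mem_iUnion.2 ⟨0, _, ih k h, ?_⟩
      ext j
      fin_cases j <;> simp [contraction, vertex, pow_succ]
      field_simp
    · refine mem_iUnion.2 ⟨1, _, ih (k - 2 ^ n) (by rw [pow_succ] at hk; omega), ?_⟩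
      ext j
      fin_cases j <;> simp [contraction, vertex, pow_succ, Nat.cast_sub h]
      field_simp
      ring

theorem base_mem_gasket (t : unitInterval) : !₂[(t : ℝ), 0] ∈ gasket := by
  have hlim : Tendsto (fun n : ℕ => (⌊(t : ℝ) * 2 ^ n⌋₊ : ℝ) / 2 ^ n) atTop (nhds (t : ℝ)) :=
    (tendsto_nat_floor_mul_div_atTop t.2.1).comp (tendsto_pow_atTop_atTop_of_one_lt one_lt_two)
  have hcont : Continuous fun s : ℝ => (!₂[s, 0] : Plane) := by
    refine (PiLp.continuous_toLp 2 _).comp (continuous_pi fun j => ?_)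
    fin_cases j
    · exact continuous_id
    · exact continuous_const
  refine mem_closure_of_tendsto ((hcont.tendsto _).comp hlim)
    (Eventually.of_forall fun n => mem_iUnion.2 ⟨n, dyadic_mem_level n _ ?_⟩)
  apply Nat.floor_le_of_le
  push_cast
  nlinarith [t.2.2, pow_pos (two_pos (α := ℝ)) n]

/-- The identification of the unit interval `I = [0,1]` with the base segment `[p₀, p₁] ⊆ K`. -/
noncomputable def base (t : unitInterval) : gasket := ⟨!₂[(t : ℝ), 0], base_mem_gasket t⟩

/-- The Hausdorff measure of dimension `d` on a metric space, normalized to have total mass one. -/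
noncomputable def normalizedHausdorff (M : Type) [MetricSpace M] [MeasurableSpace M] [BorelSpace M]
    (d : ℝ) : Measure M :=
  (μH[d] (univ : Set M))⁻¹ • (μH[d] : Measure M)

/-- The Hausdorff dimension `α₁ = log 3 / log 2` of the gasket. -/
noncomputable def dimGasket : ℝ := Real.log 3 / Real.log 2

/-- The walk dimension `β₁* = log 5 / log 2` of the gasket. -/
noncomputable def walkDimGasket : ℝ := Real.log 5 / Real.log 2

/-- The normalized Hausdorff measure on the gasket, as a metric subspace of the plane. -/
noncomputable def gasketMeasure : Measure gasket := normalizedHausdorff gasket dimGasket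

/-- The normalized Hausdorff measure on the unit interval. -/
noncomputable def intervalMeasure : Measure unitInterval := normalizedHausdorff unitInterval 1

/-- The Besov space `B^{2,2}_{α,β}(M)` of a metric measure space `(M, d, μ)`: the `u ∈ L²(M; μ)` with
`∑ₙ 2^{(α+β)n} ∫_M ∫_{d(x,y) < 2^{-n}} (u(x) - u(y))² μ(dy) μ(dx) < ∞`. -/
def besov {M : Type} [MetricSpace M] [MeasurableSpace M] (μ : Measure M) (α β : ℝ) :
    Set (Lp ℝ 2 μ) :=
  {u | ∑' n : ℕ, ENNReal.ofReal ((2 : ℝ) ^ ((α + β) * n)) *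
      ∫⁻ x, ∫⁻ y in {y | dist x y < (2 : ℝ) ^ (-(n : ℝ))},
        ENNReal.ofReal ((u x - u y) ^ 2) ∂μ ∂μ < ∞}

/-- The space of traces on `I = [p₀, p₁]` of a class `S` of functions on the gasket: the restrictions
to `I` of the continuous versions of the elements of `S`. -/
def traceSpace (S : Set (Lp ℝ 2 gasketMeasure)) : Set (Lp ℝ 2 intervalMeasure) :=
  {v | ∃ u ∈ S, ∃ g : C(gasket, ℝ), (u =ᵐ[gasketMeasure] g) ∧
    v =ᵐ[intervalMeasure] fun t => g (base t)}

end SierpinskiTrace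

namespace SierpinskiTrace

/-! The gasket and the interval are both self-similar under maps of ratio 1/2, with N = 3 and N = 2
maps and 2^d = N for the dimension d. The Besov weight 2^((d+β)n) is (N²Θ)^n with Θ = 2^(β-d). Cells
of level n have mass N^(-n), so the N² cancels against the two integrations, and the Besov condition
turns into finiteness of the discrete energy ∑ₙ Θ^n ∑ (a w - a w')². Here a is a function on words
and the inner sum runs over linked words: nearby cells of equal level, or a cell and its child.

The cell averages of a Besov function have finite energy (`energy_cellAverage_lt_top`). Conversely,
since Θ > 1, the differences of a function of finite energy decay geometrically, so it converges to
a continuous function (`exists_continuous_abs_sub_le`), and this limit lies in the Besov space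
(`mem_besov_of_energy_lt_top`). For cell averages the limit is a version of the original function
(`ae_eq_of_tracks_cellAverage`). It is the only continuous one because every non-empty open set has
positive measure.

The relation between β₁ and β₂ says that Θ is the same for both spaces. Words in the letters 0 and 1
are words of the gasket with the same links, so restricting a function on words to them does not
increase the energy (`energyAt_restrict_le`), and the limit of the restriction is the trace
(`apply_base_eq_of_tracks`).

For the extension, the values given on the cells along the base are also placed at the upper
vertices of these cells, and the cells above the base are filled in by the harmonic rule of the
gasket. Each harmonic step multiplies the energy by 3/5 (`sum_variation_harmonicStep`), while the
weight gains a factor Θ. Since β₁ < β₁* means Θ < 5/3, the product is below one and the energies sum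
up (`energy_extend_lt_top`). -/

/-! ### Words -/

/-- The words of length `n`. The head of a word is its last letter, so the children of `w` are the
words `i :: w`. -/
def words (ι : Type) [Fintype ι] : ℕ → Finset (List ι)
  | 0 => {[]}
  | n + 1 => ((Finset.univ : Finset ι) ×ˢ words ι n).map
      ⟨fun p => p.1 :: p.2, fun p q h => by
        simp only [List.cons.injEq] at h
        exact Prod.ext h.1 h.2⟩

section Words

variable {ι : Type} [Fintype ι]

theorem mem_words {n : ℕ} {w : List ι} : w ∈ words ι n ↔ w.length = n := by
  induction n generalizing w with
  | zero => simp [words, List.length_eq_zero_iff]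
  | succ n ih =>
    simp only [words, Finset.mem_map, Finset.mem_product, Finset.mem_univ, true_and, ih]
    constructor
    · rintro ⟨p, hp, rfl⟩
      exact congrArg (· + 1) hp
    · intro h
      cases w with
      | nil => simp at h
      | cons i w => exact ⟨(i, w), by simpa using h, rfl⟩

theorem card_words (n : ℕ) : (words ι n).card = Fintype.card ι ^ n := by
  induction n with
  | zero => simp [words]
  | succ n ih => simp [words, ih, pow_succ, mul_comm]

theorem sum_words_succ {A : Type*} [AddCommMonoid A] (n : ℕ) (F : List ι → A) :
    ∑ w ∈ words ι (n + 1), F w = ∑ w ∈ words ι n, ∑ i, F (i :: w) := by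
  simp only [words, Finset.sum_map, Finset.sum_product]
  exact Finset.sum_comm

theorem dim_pos {d : ℝ} (hd : (2 : ℝ) ^ d = Fintype.card ι)
    (hN : 2 ≤ Fintype.card ι) : 0 < d := by
  by_contra! h
  have h1 : (2 : ℝ) ^ d ≤ 1 := Real.rpow_le_one_of_one_le_of_nonpos one_le_two h
  have h2 : (2 : ℝ) ≤ Fintype.card ι := by exact_mod_cast hN
  linarith

theorem card_rpow {d : ℝ} (hd : (2 : ℝ) ^ d = Fintype.card ι) : (2 : ℝ≥0∞) ^ d = Fintype.card ι := by
  rw [← ENNReal.ofReal_ofNat, ENNReal.ofReal_rpow_of_pos two_pos, hd, ENNReal.ofReal_natCast]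

theorem half_pow_rpow {d : ℝ} (hd : (2 : ℝ) ^ d = Fintype.card ι) (n : ℕ) :
    (((1 / 2 : ℝ≥0∞)) ^ n) ^ d = ((Fintype.card ι : ℝ≥0∞)⁻¹) ^ n := by
  rw [← ENNReal.rpow_natCast, ← ENNReal.rpow_mul, mul_comm, ENNReal.rpow_mul, one_div,
    ENNReal.inv_rpow, card_rpow hd, ENNReal.rpow_natCast]

end Words

section InitialWord

variable {ι : Type}

/-- The word formed by the first `n` letters of a sequence. -/
def initialWord (ω : ℕ → ι) : ℕ → List ι
  | 0 => []
  | n + 1 => ω n :: initialWord ω n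

theorem length_initialWord (ω : ℕ → ι) (n : ℕ) : (initialWord ω n).length = n := by
  induction n with
  | zero => rfl
  | succ n ih => simp [initialWord, ih]

theorem initialWord_eq_iff (ω ω' : ℕ → ι) (n : ℕ) :
    initialWord ω n = initialWord ω' n ↔ ∀ k < n, ω k = ω' k := by
  induction n with
  | zero => simp [initialWord]
  | succ n ih =>
    simp only [initialWord, List.cons.injEq, ih]
    constructor
    · rintro ⟨h1, h2⟩ k hk
      rcases Nat.lt_succ_iff_lt_or_eq.1 hk with h | rfl
      · exact h2 k h
      · exact h1
    · exact fun h => ⟨h n (by omega), fun k hk => h k (by omega)⟩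

end InitialWord

/-! ### Self-similar systems of ratio one half -/

/-- A self-similar structure on a metric space whose maps halve all distances, with a relation
`link` on words which holds between a word and its children and, among words of equal length,
says up to constants that the cells are close to each other. -/
structure HalfSystem (ι : Type) [Fintype ι] (M : Type) [MetricSpace M] where
  map : ι → M → M
  dist_map : ∀ i x y, dist (map i x) (map i y) = 1 / 2 * dist x y
  cover : ∀ x, ∃ i y, map i y = x
  comp : List ι → M → M
  comp_nil : ∀ x, comp [] x = x
  comp_cons : ∀ i w x, comp (i :: w) x = comp w (map i x)
  link : List ι → Finset (List ι)
  bound : ℕ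
  card_link_le : ∀ w, (link w).card ≤ bound
  cons_mem_link : ∀ i w, i :: w ∈ link w
  length_le : ∀ w, ∀ w' ∈ link w, w'.length ≤ w.length + 1
  link_symm : ∀ w w', w.length = w'.length → w' ∈ link w → w ∈ link w'
  mem_link : ∀ w w' x y, w.length = w'.length →
    dist (comp w x) (comp w' y) < (1 / 2) ^ (w.length + 3) → w' ∈ link w
  dist_lt_of_mem_link : ∀ w, ∀ w' ∈ link w, ∀ x y,
    dist (comp w x) (comp w' y) < 8 * (1 / 2) ^ w.length

namespace HalfSystem

variable {ι : Type} [Fintype ι] {M : Type} [MetricSpace M] (S : HalfSystem ι M)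

/-- The cell of a word. -/
def cell (w : List ι) : Set M := range (S.comp w)

theorem dist_comp (w : List ι) (x y : M) :
    dist (S.comp w x) (S.comp w y) = (1 / 2) ^ w.length * dist x y := by
  induction w generalizing x y with
  | nil => simp [S.comp_nil]
  | cons i w ih =>
    rw [S.comp_cons, S.comp_cons, ih, S.dist_map, List.length_cons, pow_succ]
    ring

theorem lipschitz_comp (w : List ι) : LipschitzWith ((1 / 2) ^ w.length) (S.comp w) :=
  LipschitzWith.of_dist_le_mul fun x y => by
    rw [S.dist_comp]
    simp

theorem antilipschitz_comp (w : List ι) : AntilipschitzWith (2 ^ w.length) (S.comp w) :=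
  AntilipschitzWith.of_le_mul_dist fun x y => by
    rw [S.dist_comp, ← mul_assoc]
    simp

theorem cell_nil : S.cell [] = univ := by
  ext x
  exact ⟨fun _ => mem_univ x, fun _ => ⟨x, S.comp_nil x⟩⟩

theorem exists_mem_cell_cons {w : List ι} {x : M} (hx : x ∈ S.cell w) :
    ∃ i, x ∈ S.cell (i :: w) := by
  obtain ⟨y, rfl⟩ := hx
  obtain ⟨i, z, rfl⟩ := S.cover y
  exact ⟨i, z, S.comp_cons i w z⟩

theorem cell_cons_subset (i : ι) (w : List ι) : S.cell (i :: w) ⊆ S.cell w := by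
  rintro _ ⟨x, rfl⟩
  exact ⟨S.map i x, (S.comp_cons i w x).symm⟩

theorem mem_link_of_mem_cell {w w' : List ι} (h : w.length = w'.length) {x y : M}
    (hx : x ∈ S.cell w) (hy : y ∈ S.cell w') (hxy : dist x y < (1 / 2) ^ (w.length + 3)) :
    w' ∈ S.link w := by
  obtain ⟨x, rfl⟩ := hx
  obtain ⟨y, rfl⟩ := hy
  exact S.mem_link w w' x y h hxy

theorem mem_link_of_mem_cell_inter {w w' : List ι} (h : w.length = w'.length) {x : M}
    (hx : x ∈ S.cell w) (hx' : x ∈ S.cell w') : w' ∈ S.link w :=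
  S.mem_link_of_mem_cell h hx hx' (by rw [dist_self]; positivity)

theorem dist_lt_of_mem_cell {w w' : List ι} (h : w' ∈ S.link w) {x y : M}
    (hx : x ∈ S.cell w) (hy : y ∈ S.cell w') : dist x y < 8 * (1 / 2) ^ w.length := by
  obtain ⟨x, rfl⟩ := hx
  obtain ⟨y, rfl⟩ := hy
  exact S.dist_lt_of_mem_link w w' h x y

theorem exists_mem_words_cell (n : ℕ) (x : M) : ∃ w ∈ words ι n, x ∈ S.cell w := by
  induction n with
  | zero => exact ⟨[], by simp [words], by simp [S.cell_nil]⟩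
  | succ n ih =>
    obtain ⟨w, hw, hx⟩ := ih
    obtain ⟨i, hi⟩ := S.exists_mem_cell_cons hx
    exact ⟨i :: w, by simpa [mem_words] using hw, hi⟩

/-- Every point of a cell has an address that starts with the word of the cell. -/
theorem exists_address {w : List ι} {x : M} (hx : x ∈ S.cell w) :
    ∃ p : ℕ → List ι, p 0 = w ∧ (∀ k, ∃ i, p (k + 1) = i :: p k) ∧ ∀ k, x ∈ S.cell (p k) := by
  choose i hi using fun v : {v // x ∈ S.cell v} => S.exists_mem_cell_cons v.2
  let q : ℕ → {v // x ∈ S.cell v} := fun k =>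
    Nat.rec ⟨w, hx⟩ (fun _ v => ⟨i v :: v.1, hi v⟩) k
  exact ⟨fun k => (q k).1, rfl, fun k => ⟨i (q k), rfl⟩, fun k => (q k).2⟩

theorem isCompact_cell [CompactSpace M] (w : List ι) : IsCompact (S.cell w) :=
  isCompact_range (S.lipschitz_comp w).continuous

theorem exists_forall_mem_cell_initialWord [CompactSpace M] [Nonempty M] (ω : ℕ → ι) :
    ∃ x, ∀ n, x ∈ S.cell (initialWord ω n) := by
  have h := IsCompact.nonempty_iInter_of_sequence_nonempty_isCompact_isClosed
    (fun n => S.cell (initialWord ω n)) (fun n => S.cell_cons_subset _ _)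
    (fun n => range_nonempty _) (S.isCompact_cell _) (fun n => (S.isCompact_cell _).isClosed)
  obtain ⟨x, hx⟩ := h
  exact ⟨x, mem_iInter.1 hx⟩

/-! ### Hausdorff measure of the cells -/

section Measure

variable [MeasurableSpace M] [BorelSpace M]

/-- A cell is an exact similar copy of the space with ratio 2^(-n), so both bounds come from scaling
alone; no information on how the cells overlap is needed. -/
theorem hausdorffMeasure_cell {d : ℝ} (hd : (2 : ℝ) ^ d = Fintype.card ι)
    (hN : 2 ≤ Fintype.card ι) (w : List ι) :
    (μH[d] (S.cell w) : ℝ≥0∞) = ((Fintype.card ι : ℝ≥0∞)⁻¹) ^ w.length * μH[d] (univ : Set M) := by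
  have hd0 := (dim_pos hd hN).le
  have hc0 : (Fintype.card ι : ℝ≥0∞) ≠ 0 := by
    simp only [ne_eq, Nat.cast_eq_zero]
    omega
  rw [cell, ← image_univ]
  apply le_antisymm
  · refine ((S.lipschitz_comp w).hausdorffMeasure_image_le hd0 univ).trans_eq ?_
    rw [← half_pow_rpow hd]
    simp [ENNReal.inv_pow]
  · have h := (S.antilipschitz_comp w).le_hausdorffMeasure_image hd0 univ
    have h2 : (((2 : NNReal) ^ w.length : NNReal) : ℝ≥0∞) ^ d = (Fintype.card ι : ℝ≥0∞) ^ w.length := by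
      push_cast
      rw [← ENNReal.rpow_natCast, ← ENNReal.rpow_mul, mul_comm, ENNReal.rpow_mul, card_rpow hd,
        ENNReal.rpow_natCast]
    rw [h2] at h
    calc _ ≤ ((Fintype.card ι : ℝ≥0∞)⁻¹) ^ w.length *
          ((Fintype.card ι : ℝ≥0∞) ^ w.length * μH[d] (S.comp w '' univ)) := by gcongr
      _ = _ := by
        rw [← mul_assoc, ← mul_pow, ENNReal.inv_mul_cancel hc0 (ENNReal.natCast_ne_top _), one_pow,
          one_mul]

variable [CompactSpace M]

theorem measurableSet_cell (w : List ι) : MeasurableSet (S.cell w) :=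
  (S.isCompact_cell w).measurableSet

/-- The N^n cells of level n cover the space, and each contributes at most N^(-n) D^d to the
Hausdorff sum, where D is the diameter. -/
theorem hausdorffMeasure_univ_lt_top (S : HalfSystem ι M) {d : ℝ} (hd : (2 : ℝ) ^ d = Fintype.card ι)
    (hN : 2 ≤ Fintype.card ι) : (μH[d] (univ : Set M) : ℝ≥0∞) < ∞ := by
  have hd0 := (dim_pos hd hN).le
  have hc0 : (Fintype.card ι : ℝ≥0∞) ≠ 0 := by
    simp only [ne_eq, Nat.cast_eq_zero]
    omega
  set D : ℝ≥0∞ := Metric.ediam (univ : Set M) with hD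
  have hDt : D ≠ ∞ := (isCompact_univ (X := M)).isBounded.ediam_ne_top
  have hdiam : ∀ w : List ι, Metric.ediam (S.cell w) ≤ (1 / 2) ^ w.length * D := fun w => by
    have := (S.lipschitz_comp w).ediam_image_le univ
    rw [image_univ] at this
    simpa [cell, ENNReal.inv_pow] using this
  have hlim : Tendsto (fun n : ℕ => (1 / 2 : ℝ≥0∞) ^ n * D) atTop (nhds 0) := by
    have := ENNReal.Tendsto.mul_const (b := D)
      (ENNReal.tendsto_pow_atTop_nhds_zero_of_lt_one (r := 1 / 2) (by simp)) (Or.inr hDt)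
    simpa using this
  have h := Measure.hausdorffMeasure_le_liminf_sum (ι := fun n => words ι n) d (univ : Set M)
    (fun n : ℕ => (1 / 2 : ℝ≥0∞) ^ n * D) hlim (fun n w => S.cell w.1)
    (Eventually.of_forall fun n w => (hdiam w.1).trans_eq (by rw [mem_words.1 w.2]))
    (Eventually.of_forall fun n x _ => by
      obtain ⟨w, hw, hx⟩ := S.exists_mem_words_cell n x
      exact mem_iUnion.2 ⟨⟨w, hw⟩, hx⟩)
  refine h.trans_lt (lt_of_le_of_lt (liminf_le_of_le (a := D ^ d) (by isBoundedDefault) ?_)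
    (ENNReal.rpow_lt_top_of_nonneg hd0 hDt))
  intro b hb
  obtain ⟨n, hn⟩ := hb.exists
  refine hn.trans ?_
  calc ∑ w : words ι n, Metric.ediam (S.cell w.1) ^ d
      ≤ ∑ w : words ι n, ((Fintype.card ι : ℝ≥0∞)⁻¹) ^ n * D ^ d := by
        refine Finset.sum_le_sum fun w _ => ?_
        rw [← half_pow_rpow hd, ← ENNReal.mul_rpow_of_nonneg _ _ hd0]
        refine ENNReal.rpow_le_rpow ((hdiam w.1).trans_eq ?_) hd0
        rw [mem_words.1 w.2]
    _ = D ^ d := by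
        rw [Finset.sum_const, nsmul_eq_mul, ← mul_assoc, Finset.card_univ, Fintype.card_coe,
          card_words, Nat.cast_pow, ← mul_pow,
          ENNReal.mul_inv_cancel hc0 (ENNReal.natCast_ne_top _), one_pow, one_mul]

/-- The uniform Bernoulli measure on sequences gives mass at most `N⁻ⁿ` to cylinders. -/
theorem bernoulli_cylinder_le [Nonempty ι] [MeasurableSpace ι] [MeasurableSingletonClass ι]
    (n : ℕ) (w : List ι) :
    Measure.infinitePi (fun _ : ℕ => ProbabilityTheory.uniformOn (univ : Set ι))
      {ω | initialWord ω n = w} ≤ ((Fintype.card ι : ℝ≥0∞)⁻¹) ^ n := by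
  rcases eq_empty_or_nonempty {ω : ℕ → ι | initialWord ω n = w} with h | ⟨ω₀, h₀⟩
  · simp [h]
  have hsub : {ω : ℕ → ι | initialWord ω n = w} = Set.pi (Finset.range n) fun k => {ω₀ k} := by
    ext ω
    rw [← (show initialWord ω₀ n = w from h₀)]
    simp [initialWord_eq_iff]
  rw [hsub, Measure.infinitePi_pi _ (fun i _ => measurableSet_singleton _)]
  refine le_of_eq ?_
  have h1 : ∀ k, ProbabilityTheory.uniformOn (univ : Set ι) {ω₀ k} = (Fintype.card ι : ℝ≥0∞)⁻¹ := by
    intro k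
    rw [ProbabilityTheory.uniformOn_univ]
    simp
  simp [h1]

/-- The mass distribution principle for a self-similar system. -/
theorem hausdorffMeasure_univ_pos (S : HalfSystem ι M) [Nonempty M] {d : ℝ}
    (hd : (2 : ℝ) ^ d = Fintype.card ι) (hN : 2 ≤ Fintype.card ι) :
    0 < (μH[d] (univ : Set M) : ℝ≥0∞) := by
  have hd0 := dim_pos hd hN
  have hι : Nonempty ι := Fintype.card_pos_iff.1 (by omega)
  let _ : MeasurableSpace ι := ⊤
  have _ : MeasurableSingletonClass ι := ⟨fun _ => trivial⟩
  set P := Measure.infinitePi (fun _ : ℕ => ProbabilityTheory.uniformOn (univ : Set ι)) with hP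
  -- A coding map: π sends a sequence to some point in all the cells of its initial words.
  choose π hπ using S.exists_forall_mem_cell_initialWord
  have hsmall : ∀ (s : Set M) (n : ℕ), (∀ x ∈ s, ∀ y ∈ s, dist x y < (1 / 2) ^ (n + 3)) →
      P (π ⁻¹' s) ≤ S.bound * ((Fintype.card ι : ℝ≥0∞)⁻¹) ^ n := by
    intro s n hs
    rcases (π ⁻¹' s).eq_empty_or_nonempty with h | ⟨ω₀, h₀⟩
    · simp [h]
    -- A set this small meets only cells linked to one fixed cell, and there are at most `S.bound`
    -- of these.
    have hsub : π ⁻¹' s ⊆ ⋃ w ∈ (S.link (initialWord ω₀ n)).filter (fun w => w.length = n),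
        {ω | initialWord ω n = w} := by
      intro ω hω
      refine mem_biUnion (x := initialWord ω n) ?_ rfl
      simp only [Finset.coe_filter, mem_ofPred_eq, length_initialWord, and_true]
      refine S.mem_link_of_mem_cell (by simp [length_initialWord]) (hπ ω₀ n) (hπ ω n) ?_
      rw [length_initialWord]
      exact hs _ h₀ _ hω
    refine (measure_mono hsub).trans ((measure_biUnion_finset_le _ _).trans ?_)
    calc _ ≤ ∑ w ∈ (S.link (initialWord ω₀ n)).filter (fun w => w.length = n),
          ((Fintype.card ι : ℝ≥0∞)⁻¹) ^ n :=
          Finset.sum_le_sum fun w _ => bernoulli_cylinder_le n w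
      _ ≤ _ := by
          rw [Finset.sum_const, nsmul_eq_mul]
          gcongr
          exact (Finset.card_filter_le _ _).trans (S.card_link_le _)
  -- The diameter will be placed between 2^(-(n+4)) and 2^(-(n+3)), so that 2^(-n) is at most 16
  -- times the diameter.
  set C : ℝ≥0∞ := S.bound * (16 : ℝ≥0∞) ^ d with hC
  have hCt : C ≠ ∞ := ENNReal.mul_ne_top (ENNReal.natCast_ne_top _)
    (ENNReal.rpow_ne_top_of_nonneg hd0.le (by simp))
  have hN1 : (Fintype.card ι : ℝ≥0∞)⁻¹ < 1 := by
    rw [ENNReal.inv_lt_one]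
    exact_mod_cast hN
  have hdiam : ∀ s : Set M, Metric.ediam s ≤ 1 / 16 → P (π ⁻¹' s) ≤ C * Metric.ediam s ^ d := by
    intro s hs
    have hst : Metric.ediam s ≠ ∞ := ne_top_of_le_ne_top (by simp) hs
    have hlt : ∀ n : ℕ, Metric.ediam s < (1 / 2) ^ (n + 3) →
        P (π ⁻¹' s) ≤ S.bound * ((Fintype.card ι : ℝ≥0∞)⁻¹) ^ n := by
      intro n hn
      refine hsmall s n fun x hx y hy => ?_
      have h1 := (Metric.edist_le_ediam_of_mem hx hy).trans_lt hn
      rw [edist_dist] at h1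
      have h2 : ((1 / 2 : ℝ≥0∞)) ^ (n + 3) = ENNReal.ofReal ((1 / 2) ^ (n + 3)) := by
        rw [ENNReal.ofReal_pow (by norm_num)]
        congr 1
        rw [ENNReal.ofReal_div_of_pos two_pos]
        simp
      rw [h2] at h1
      exact (ENNReal.ofReal_lt_ofReal_iff (by positivity)).1 h1
    rcases eq_or_ne (Metric.ediam s) 0 with h0 | h0
    · have : P (π ⁻¹' s) ≤ 0 := by
        have hl : Tendsto (fun n => (S.bound : ℝ≥0∞) * ((Fintype.card ι : ℝ≥0∞)⁻¹) ^ n) atTop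
            (nhds (S.bound * 0)) :=
          ENNReal.Tendsto.const_mul (ENNReal.tendsto_pow_atTop_nhds_zero_of_lt_one hN1)
            (Or.inr (ENNReal.natCast_ne_top _))
        rw [mul_zero] at hl
        refine ge_of_tendsto' hl fun n => hlt n ?_
        rw [h0]
        exact ENNReal.pow_pos (by simp) _
      exact this.trans (bot_le)
    · have hex : ∃ n : ℕ, (1 / 2 : ℝ≥0∞) ^ (n + 4) ≤ Metric.ediam s := by
        obtain ⟨n, hn⟩ := ((ENNReal.tendsto_pow_atTop_nhds_zero_of_lt_one
          (r := (1 / 2 : ℝ≥0∞)) (by simp)).eventually_lt_const h0.bot_lt).exists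
        exact ⟨n, le_trans (pow_le_pow_right_of_le_one' (by simp) (by omega)) hn.le⟩
      classical
      set n := Nat.find hex with hn
      have hn1 : (1 / 2 : ℝ≥0∞) ^ (n + 4) ≤ Metric.ediam s := Nat.find_spec hex
      have hn2 : Metric.ediam s < (1 / 2) ^ (n + 3) := by
        rcases Nat.eq_zero_or_pos n with h | h
        · rw [h]
          refine hs.trans_lt ?_
          rw [one_div, one_div, zero_add, ← ENNReal.inv_pow, ENNReal.inv_lt_inv]
          norm_num
        · have := Nat.find_min hex (m := n - 1) (by omega)
          rw [show n - 1 + 4 = n + 3 by omega] at this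
          exact not_le.1 this
      refine (hlt n hn2).trans ?_
      rw [hC, mul_assoc]
      gcongr
      rw [← half_pow_rpow hd, ← ENNReal.mul_rpow_of_nonneg _ _ hd0.le]
      refine ENNReal.rpow_le_rpow ?_ hd0.le
      calc (1 / 2 : ℝ≥0∞) ^ n = 16 * (1 / 2) ^ (n + 4) := by
            rw [pow_add, mul_comm, mul_assoc]
            have : (1 / 2 : ℝ≥0∞) ^ 4 * 16 = 1 := by
              rw [one_div, ← ENNReal.inv_pow, show (2 : ℝ≥0∞) ^ 4 = 16 by norm_num]
              exact ENNReal.inv_mul_cancel (by simp) (by simp)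
            rw [this, mul_one]
        _ ≤ _ := by gcongr
  -- The comparison is made between outer measures because π was chosen pointwise and is not known
  -- to be measurable.
  have hle : C⁻¹ • OuterMeasure.map π P.toOuterMeasure
      ≤ (OuterMeasure.mkMetric (fun r => r ^ d) : OuterMeasure M) := by
    refine OuterMeasure.le_mkMetric _ _ (1 / 16) (by simp) fun s hs => ?_
    simp only [smul_apply, OuterMeasure.map_apply, Measure.coe_toOuterMeasure,
      smul_eq_mul]
    calc C⁻¹ * P (π ⁻¹' s) ≤ C⁻¹ * (C * Metric.ediam s ^ d) := by
          gcongr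
          exact hdiam s hs
      _ ≤ 1 * Metric.ediam s ^ d := by
          rw [← mul_assoc]
          gcongr
          exact ENNReal.inv_mul_le_one _
      _ = _ := one_mul _
  have h := hle univ
  simp only [smul_apply, OuterMeasure.map_apply, Measure.coe_toOuterMeasure,
    smul_eq_mul, preimage_univ, measure_univ, mul_one] at h
  rw [OuterMeasure.coe_mkMetric] at h
  exact lt_of_lt_of_le (ENNReal.inv_pos.2 hCt) h

theorem isProbabilityMeasure_normalizedHausdorff (S : HalfSystem ι M) [Nonempty M] {d : ℝ}
    (hd : (2 : ℝ) ^ d = Fintype.card ι) (hN : 2 ≤ Fintype.card ι) :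
    IsProbabilityMeasure (normalizedHausdorff M d) :=
  ⟨ENNReal.inv_mul_cancel (S.hausdorffMeasure_univ_pos hd hN).ne'
    (S.hausdorffMeasure_univ_lt_top hd hN).ne⟩

theorem normalizedHausdorff_cell [Nonempty M] {d : ℝ} (hd : (2 : ℝ) ^ d = Fintype.card ι)
    (hN : 2 ≤ Fintype.card ι) (w : List ι) :
    normalizedHausdorff M d (S.cell w) = ((Fintype.card ι : ℝ≥0∞)⁻¹) ^ w.length := by
  rw [normalizedHausdorff, Measure.smul_apply, smul_eq_mul, S.hausdorffMeasure_cell hd hN,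
    mul_left_comm, ENNReal.inv_mul_cancel (S.hausdorffMeasure_univ_pos hd hN).ne'
    (S.hausdorffMeasure_univ_lt_top hd hN).ne, mul_one]

end Measure

end HalfSystem

/-! ### Recursive inequalities -/

/-- The recursion runs backwards, from fine levels to coarse ones. Iterating it k times leaves the
remainder κ^k Y (n+k), which must be assumed to vanish: otherwise Y = ∞ could satisfy the recursion
with E = 0. -/
theorem le_tsum_of_le_mul_succ_add {κ : ℝ≥0∞} {Y E : ℕ → ℝ≥0∞}
    (h : ∀ n, Y n ≤ κ * Y (n + 1) + E n)
    (hlim : ∀ n, Tendsto (fun k => κ ^ k * Y (n + k)) atTop (nhds 0)) (n : ℕ) :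
    Y n ≤ ∑' j, κ ^ j * E (n + j) := by
  have hfin : ∀ k, Y n ≤ κ ^ k * Y (n + k) + ∑ j ∈ Finset.range k, κ ^ j * E (n + j) := by
    intro k
    induction k with
    | zero => simp
    | succ k ih =>
      refine ih.trans ?_
      rw [Finset.sum_range_succ, pow_succ, mul_assoc]
      calc _ ≤ κ ^ k * (κ * Y (n + k + 1) + E (n + k)) +
            ∑ j ∈ Finset.range k, κ ^ j * E (n + j) := by gcongr; exact h _
        _ = _ := by rw [mul_add, add_assoc, add_assoc, add_comm (κ ^ k * E (n + k))]
  have hl := (hlim n).add_const (∑' j, κ ^ j * E (n + j))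
  rw [zero_add] at hl
  exact ge_of_tendsto' hl fun k => (hfin k).trans (by gcongr; exact ENNReal.sum_le_tsum _)

theorem tsum_le_of_le_mul_succ_add {κ : ℝ≥0∞} {Y E : ℕ → ℝ≥0∞}
    (h : ∀ n, Y n ≤ κ * Y (n + 1) + E n)
    (hlim : ∀ n, Tendsto (fun k => κ ^ k * Y (n + k)) atTop (nhds 0)) :
    ∑' n, Y n ≤ (1 - κ)⁻¹ * ∑' n, E n := by
  calc ∑' n, Y n ≤ ∑' n, ∑' j, κ ^ j * E (n + j) :=
        ENNReal.tsum_le_tsum fun n => le_tsum_of_le_mul_succ_add h hlim n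
    _ = ∑' j, κ ^ j * ∑' n, E (n + j) := by
        rw [ENNReal.tsum_comm]
        simp_rw [ENNReal.tsum_mul_left]
    _ ≤ ∑' j, κ ^ j * ∑' n, E n := by
        exact ENNReal.tsum_le_tsum fun j => mul_le_mul' le_rfl
          (ENNReal.tsum_comp_le_tsum_of_injective (add_left_injective j) E)
    _ = _ := by rw [ENNReal.tsum_mul_right, ENNReal.tsum_geometric]

/-- Used with m = 3 to absorb the factor 8 between the scale of a cell and the distances that `link`
controls. -/
theorem tsum_lt_top_of_shift {f : ℕ → ℝ≥0∞} (m : ℕ) (hf : ∀ n, f n < ∞)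
    (h : ∑' n, f (n + m) < ∞) : ∑' n, f n < ∞ := by
  rw [← Summable.sum_add_tsum_nat_add' (k := m) ENNReal.summable]
  exact ENNReal.add_lt_top.2 ⟨ENNReal.sum_lt_top.2 fun n _ => hf n, h⟩

theorem setLIntegral_le_sum {X κ : Type*} [MeasurableSpace X] {μ : Measure X} {s : Set X}
    {F : Finset κ} {t : κ → Set X} (h : s ⊆ ⋃ k ∈ F, t k) (f : X → ℝ≥0∞) :
    ∫⁻ x in s, f x ∂μ ≤ ∑ k ∈ F, ∫⁻ x in t k, f x ∂μ := by
  refine (lintegral_mono_set h).trans ?_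
  rw [← Finset.set_biUnion_coe, biUnion_eq_iUnion, ← Finset.tsum_subtype]
  exact lintegral_iUnion_le (fun k : F => t k) f

/-! ### Besov energies -/

/-- The double integral of `(f x - f y)²` over `d(x, y) < r`. -/
noncomputable def increment {M : Type} [MetricSpace M] [MeasurableSpace M] (μ : Measure M)
    (f : M → ℝ) (r : ℝ) : ℝ≥0∞ :=
  ∫⁻ x, ∫⁻ y in {y | dist x y < r}, ENNReal.ofReal ((f x - f y) ^ 2) ∂μ ∂μ

theorem increment_congr {M : Type} [MetricSpace M] [MeasurableSpace M] {μ : Measure M}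
    {f g : M → ℝ} (h : f =ᵐ[μ] g) (r : ℝ) : increment μ f r = increment μ g r := by
  refine lintegral_congr_ae ?_
  filter_upwards [h] with x hx
  refine lintegral_congr_ae (ae_restrict_of_ae ?_)
  filter_upwards [h] with y hy
  rw [hx, hy]

/-- In the factored weight, N² compensates the masses of a pair of cells, and 2^(β-α) is what
remains as the weight of the discrete energy. -/
theorem mem_besov_iff {M : Type} [MetricSpace M] [MeasurableSpace M] {μ : Measure M} {α β N : ℝ}
    (hN : (2 : ℝ) ^ α = N) (u : Lp ℝ 2 μ) :
    u ∈ besov μ α β ↔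
      ∑' n : ℕ, ENNReal.ofReal (N ^ 2 * 2 ^ (β - α)) ^ n * increment μ u ((1 / 2) ^ n) < ∞ := by
  have h1 : ∀ n : ℕ, ENNReal.ofReal ((2 : ℝ) ^ ((α + β) * n)) =
      ENNReal.ofReal (N ^ 2 * 2 ^ (β - α)) ^ n := fun n => by
    rw [← ENNReal.ofReal_pow (by positivity), ← hN, sq, ← Real.rpow_add two_pos,
      ← Real.rpow_add two_pos, Real.rpow_mul two_pos.le, Real.rpow_natCast]
    ring_nf
  have h2 : ∀ n : ℕ, (2 : ℝ) ^ (-(n : ℝ)) = (1 / 2) ^ n := fun n => by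
    rw [Real.rpow_neg two_pos.le, Real.rpow_natCast, one_div, inv_pow]
  simp only [besov, mem_ofPred_eq, h1, h2, increment]

namespace HalfSystem

variable {ι : Type} [Fintype ι] {M : Type} [MetricSpace M] (S : HalfSystem ι M)

/-- The discrete energy at level `n` of a function on words. -/
noncomputable def energyAt (a : List ι → ℝ) (n : ℕ) : ℝ≥0∞ :=
  ∑ w ∈ words ι n, ∑ w' ∈ S.link w, ENNReal.ofReal ((a w - a w') ^ 2)

/-- The discrete Besov energy of a function on words. -/
noncomputable def energy (Θ : ℝ) (a : List ι → ℝ) : ℝ≥0∞ :=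
  ∑' n, ENNReal.ofReal Θ ^ n * S.energyAt a n

theorem ofReal_sq_sub_le_energyAt (a : List ι → ℝ) {w w' : List ι} (h : w' ∈ S.link w) :
    ENNReal.ofReal ((a w - a w') ^ 2) ≤ S.energyAt a w.length :=
  (Finset.single_le_sum (f := fun w' => ENNReal.ofReal ((a w - a w') ^ 2))
    (fun _ _ => zero_le) h).trans
    (Finset.single_le_sum
      (f := fun w => ∑ w' ∈ S.link w, ENNReal.ofReal ((a w - a w') ^ 2))
      (fun _ _ => zero_le) (mem_words.2 rfl))

theorem sum_children_le_sum_link (w : List ι) (f : List ι → ℝ≥0∞) :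
    ∑ i, f (i :: w) ≤ ∑ w' ∈ S.link w, f w' := by
  have hinj : Function.Injective fun i : ι => i :: w := fun i j h => (List.cons.inj h).1
  have h := Finset.sum_map Finset.univ ⟨fun i : ι => i :: w, hinj⟩ f
  simp only [Function.Embedding.coeFn_mk] at h
  rw [← h]
  refine Finset.sum_le_sum_of_subset fun v hv => ?_
  obtain ⟨i, -, rfl⟩ := Finset.mem_map.1 hv
  exact S.cons_mem_link i w

/-- A single squared difference, with its weight Θ^n, is at most the total energy. -/
theorem exists_abs_sub_le {Θ : ℝ} (hΘ : 1 < Θ) {a : List ι → ℝ} (ha : S.energy Θ a < ∞) :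
    ∃ C, 0 ≤ C ∧ ∀ w, ∀ w' ∈ S.link w, |a w - a w'| ≤ C * (√Θ)⁻¹ ^ w.length := by
  refine ⟨√(S.energy Θ a).toReal, Real.sqrt_nonneg _, fun w w' h => ?_⟩
  have hΘ0 : 0 < Θ := by linarith
  have h1 : ENNReal.ofReal (Θ ^ w.length * (a w - a w') ^ 2) ≤ S.energy Θ a := by
    rw [ENNReal.ofReal_mul (by positivity), ENNReal.ofReal_pow hΘ0.le]
    refine le_trans ?_ (ENNReal.le_tsum w.length)
    gcongr
    exact S.ofReal_sq_sub_le_energyAt a h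
  have h2 := (ENNReal.ofReal_le_iff_le_toReal ha.ne).1 h1
  have h3 : (√Θ)⁻¹ ^ w.length = √((Θ ^ w.length)⁻¹) := by
    rw [Real.sqrt_inv, show Θ ^ w.length = (√Θ ^ w.length) ^ 2 by
      rw [← pow_mul, mul_comm, pow_mul, Real.sq_sqrt hΘ0.le], Real.sqrt_sq (by positivity), inv_pow]
  rw [h3, ← Real.sqrt_mul ENNReal.toReal_nonneg]
  apply Real.abs_le_sqrt
  rw [← div_eq_mul_inv, le_div_iff₀ (by positivity), mul_comm]
  exact h2

/-- The function `g` is the limit of the values of `a` on the cells around a point. -/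
def Tracks (g : M → ℝ) (a : List ι → ℝ) : Prop :=
  ∀ ε > 0, ∃ n, ∀ w : List ι, n ≤ w.length → ∀ x ∈ S.cell w, |g x - a w| ≤ ε

/-- A function of finite Besov energy on words converges to a continuous function. -/
theorem exists_continuous_abs_sub_le {Θ : ℝ} (hΘ : 1 < Θ) {a : List ι → ℝ}
    (ha : S.energy Θ a < ∞) : ∃ g : C(M, ℝ), ∃ C, 0 ≤ C ∧
      ∀ w, ∀ x ∈ S.cell w, |g x - a w| ≤ C * (√Θ)⁻¹ ^ w.length := by
  obtain ⟨C, hC, hstep⟩ := S.exists_abs_sub_le hΘ ha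
  set ρ := (√Θ)⁻¹ with hρ
  have hρ0 : 0 < ρ := by positivity
  have hρ1 : ρ < 1 := inv_lt_one_of_one_lt₀ (Real.lt_sqrt_of_sq_lt (by simpa using hΘ))
  choose p hp0 hp1 hp2 using fun x : M => S.exists_address (w := []) (x := x) (by simp [S.cell_nil])
  have hlen : ∀ x k, (p x k).length = k := fun x k => by
    induction k with
    | zero => simp [hp0]
    | succ k ih =>
      obtain ⟨i, hi⟩ := hp1 x k
      simp [hi, ih]
  have hdist : ∀ x k, dist (a (p x k)) (a (p x (k + 1))) ≤ C * ρ ^ k := fun x k => by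
    obtain ⟨i, hi⟩ := hp1 x k
    rw [hi, Real.dist_eq]
    exact (hstep _ _ (S.cons_mem_link i _)).trans_eq (by rw [hlen])
  choose g hg using fun x => cauchySeq_tendsto_of_complete
    (cauchySeq_of_le_geometric ρ C hρ1 (hdist x))
  have hgp : ∀ x k, |g x - a (p x k)| ≤ C * ρ ^ k / (1 - ρ) := fun x k => by
    rw [abs_sub_comm, ← Real.dist_eq]
    exact dist_le_of_le_geometric_of_tendsto ρ C hρ1 (hdist x) (hg x) k
  -- The first summand is the geometric tail along the chosen address of x; the second is one link
  -- step from the cell of that address to an arbitrary cell of the same level containing x.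
  set C' := C / (1 - ρ) + C with hC'
  have hC'0 : 0 ≤ C' := add_nonneg (div_nonneg hC (by linarith)) hC
  have hbound : ∀ w, ∀ x ∈ S.cell w, |g x - a w| ≤ C' * ρ ^ w.length := fun w x hx => by
    have h1 := hgp x w.length
    have h2 := hstep (p x w.length) w
      (S.mem_link_of_mem_cell_inter (hlen _ _) (hp2 x _) hx)
    rw [hlen] at h2
    calc |g x - a w| ≤ |g x - a (p x w.length)| + |a (p x w.length) - a w| := abs_sub_le _ _ _
      _ ≤ C * ρ ^ w.length / (1 - ρ) + C * ρ ^ w.length := add_le_add h1 h2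
      _ = _ := by rw [hC']; ring
  have hcont : Continuous g := by
    rw [Metric.continuous_iff]
    intro x ε hε
    have hlim : Tendsto (fun n : ℕ => (2 * C' + C) * ρ ^ n) atTop (nhds 0) := by
      simpa using (tendsto_pow_atTop_nhds_zero_of_lt_one hρ0.le hρ1).const_mul (2 * C' + C)
    obtain ⟨n, hn⟩ := (hlim.eventually_lt_const hε).exists
    -- At this distance the level-n cells of x and y are linked.
    refine ⟨(1 / 2) ^ (n + 3), by positivity, fun y hy => lt_of_le_of_lt ?_ hn⟩
    have h1 := hbound _ _ (hp2 y n)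
    have h2 := hbound _ _ (hp2 x n)
    have h3 := hstep (p y n) (p x n) (S.mem_link_of_mem_cell (by rw [hlen, hlen]) (hp2 y n)
      (hp2 x n) (by rwa [hlen]))
    rw [hlen] at h1 h2 h3
    rw [Real.dist_eq]
    calc |g y - g x| = |(g y - a (p y n)) + (a (p y n) - a (p x n)) - (g x - a (p x n))| := by
          ring_nf
      _ ≤ |(g y - a (p y n)) + (a (p y n) - a (p x n))| + |g x - a (p x n)| := abs_sub _ _
      _ ≤ |g y - a (p y n)| + |a (p y n) - a (p x n)| + |g x - a (p x n)| := by
          gcongr; exact abs_add_le _ _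
      _ ≤ _ := by linarith
  exact ⟨⟨g, hcont⟩, C', hC'0, hbound⟩

theorem tracks_of_abs_sub_le {Θ : ℝ} (hΘ : 1 < Θ) {a : List ι → ℝ} {g : M → ℝ} {C : ℝ}
    (h : ∀ w, ∀ x ∈ S.cell w, |g x - a w| ≤ C * (√Θ)⁻¹ ^ w.length) : S.Tracks g a := by
  intro ε hε
  have hρ1 : (√Θ)⁻¹ < 1 := inv_lt_one_of_one_lt₀ (Real.lt_sqrt_of_sq_lt (by simpa using hΘ))
  have hlim : Tendsto (fun n : ℕ => C * (√Θ)⁻¹ ^ n) atTop (nhds 0) := by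
    simpa using (tendsto_pow_atTop_nhds_zero_of_lt_one (by positivity) hρ1).const_mul C
  obtain ⟨n, hn⟩ := eventually_atTop.1 (hlim.eventually_lt_const hε)
  exact ⟨n, fun w hw x hx => (h w x hx).trans (hn _ hw).le⟩

end HalfSystem

/-! ### From finite discrete energy to the Besov space -/

theorem add_sq_le_one_add_mul {ε : ℝ} (hε : 0 < ε) (u v : ℝ) :
    (u + v) ^ 2 ≤ (1 + ε) * u ^ 2 + (1 + ε⁻¹) * v ^ 2 := by
  have h1 : 0 ≤ ε⁻¹ * (ε * u - v) ^ 2 := by positivity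
  have h2 : ε⁻¹ * (ε * u - v) ^ 2 = ε * u ^ 2 - 2 * u * v + ε⁻¹ * v ^ 2 := by
    field_simp
    ring
  linarith

theorem ofReal_sq_sub_le (p q r s : ℝ) :
    ENNReal.ofReal ((p - s) ^ 2) ≤ 3 * (ENNReal.ofReal ((p - q) ^ 2) +
      ENNReal.ofReal ((q - r) ^ 2) + ENNReal.ofReal ((s - r) ^ 2)) := by
  rw [← ENNReal.ofReal_add (by positivity) (by positivity),
    ← ENNReal.ofReal_add (by positivity) (by positivity), ← ENNReal.ofReal_ofNat,
    ← ENNReal.ofReal_mul (by norm_num)]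
  apply ENNReal.ofReal_le_ofReal
  nlinarith [sq_nonneg ((p - q) - (q - r)), sq_nonneg ((p - q) - (r - s)),
    sq_nonneg ((q - r) - (r - s))]

namespace HalfSystem

variable {ι : Type} [Fintype ι] {M : Type} [MetricSpace M] (S : HalfSystem ι M)
  [MeasurableSpace M]

/-- The mean square deviation at level `n` of `g` from `a`. -/
noncomputable def deviationAt (μ : Measure M) (g : M → ℝ) (a : List ι → ℝ) (n : ℕ) : ℝ≥0∞ :=
  ∑ w ∈ words ι n, ∫⁻ x in S.cell w, ENNReal.ofReal ((g x - a w) ^ 2) ∂μ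

variable [BorelSpace M] {μ : Measure M}

/-- On each child cell, g - a w splits into the deviation from the child's value and the difference
between parent and child, which is part of the energy. The weighted square inequality keeps the
factor of the first part close to one. -/
theorem deviationAt_le_succ
    (hμ : ∀ w, μ (S.cell w) = ((Fintype.card ι : ℝ≥0∞)⁻¹) ^ w.length)
    (a : List ι → ℝ) (g : C(M, ℝ)) {ε : ℝ} (hε : 0 < ε) (n : ℕ) :
    S.deviationAt μ g a n ≤ ENNReal.ofReal (1 + ε) * S.deviationAt μ g a (n + 1) +
      ENNReal.ofReal (1 + ε⁻¹) * (((Fintype.card ι : ℝ≥0∞)⁻¹) ^ (n + 1) * S.energyAt a n) := by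
  have hg : ∀ w, Measurable fun x => ENNReal.ofReal ((g x - a w) ^ 2) := fun w => by
    have := g.continuous
    exact (by fun_prop : Continuous fun x => (g x - a w) ^ 2).measurable.ennreal_ofReal
  calc S.deviationAt μ g a n
      ≤ ∑ w ∈ words ι n, ∑ i, (ENNReal.ofReal (1 + ε) *
          ∫⁻ x in S.cell (i :: w), ENNReal.ofReal ((g x - a (i :: w)) ^ 2) ∂μ +
          ENNReal.ofReal (1 + ε⁻¹) * (((Fintype.card ι : ℝ≥0∞)⁻¹) ^ (n + 1) *
            ENNReal.ofReal ((a w - a (i :: w)) ^ 2))) := by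
        refine Finset.sum_le_sum fun w hw => ?_
        have hsub : S.cell w ⊆ ⋃ i ∈ (Finset.univ : Finset ι), S.cell (i :: w) := fun x hx => by
          obtain ⟨i, hi⟩ := S.exists_mem_cell_cons hx
          simpa using ⟨i, hi⟩
        refine (setLIntegral_le_sum hsub _).trans (Finset.sum_le_sum fun i _ => ?_)
        have hlen : (i :: w).length = n + 1 := by simp [mem_words.1 hw]
        rw [← hlen, ← hμ, ← lintegral_const_mul _ (hg _), mul_comm (μ _), ← mul_assoc,
          ← setLIntegral_const, ← lintegral_add_left ((hg _).const_mul _)]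
        refine lintegral_mono fun x => ?_
        rw [← ENNReal.ofReal_mul (by positivity), ← ENNReal.ofReal_mul (by positivity),
          ← ENNReal.ofReal_add (by positivity) (by positivity)]
        apply ENNReal.ofReal_le_ofReal
        have := add_sq_le_one_add_mul hε (g x - a (i :: w)) (a (i :: w) - a w)
        rw [sub_add_sub_cancel] at this
        rwa [← neg_sub (a (i :: w)) (a w), neg_sq]
    _ ≤ _ := by
        simp_rw [Finset.sum_add_distrib, ← Finset.mul_sum, ← sum_words_succ n
          (fun w => ∫⁻ x in S.cell w, ENNReal.ofReal ((g x - a w) ^ 2) ∂μ)]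
        unfold energyAt
        gcongr with w hw
        · rfl
        · exact S.sum_children_le_sum_link w fun w' => ENNReal.ofReal ((a w - a w') ^ 2)

variable [CompactSpace M]

theorem deviationAt_le_of_abs_sub_le
    (hμ : ∀ w, μ (S.cell w) = ((Fintype.card ι : ℝ≥0∞)⁻¹) ^ w.length) (hN : 2 ≤ Fintype.card ι)
    {a : List ι → ℝ} {g : M → ℝ} {n : ℕ} {δ : ℝ}
    (h : ∀ w, w.length = n → ∀ x ∈ S.cell w, |g x - a w| ≤ δ) :
    S.deviationAt μ g a n ≤ ENNReal.ofReal (δ ^ 2) := by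
  have hc0 : (Fintype.card ι : ℝ≥0∞) ≠ 0 := by
    simp only [ne_eq, Nat.cast_eq_zero]
    omega
  calc S.deviationAt μ g a n
      ≤ ∑ w ∈ words ι n, ENNReal.ofReal (δ ^ 2) * ((Fintype.card ι : ℝ≥0∞)⁻¹) ^ n := by
        refine Finset.sum_le_sum fun w hw => ?_
        have hw := mem_words.1 hw
        rw [← hw, ← hμ, ← setLIntegral_const]
        refine setLIntegral_mono' (S.measurableSet_cell w) fun x hx => ?_
        exact ENNReal.ofReal_le_ofReal (sq_le_sq' (abs_le.1 (h w hw x hx)).1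
          (abs_le.1 (h w hw x hx)).2)
    _ = ENNReal.ofReal (δ ^ 2) := by
        rw [Finset.sum_const, card_words, nsmul_eq_mul, mul_left_comm, Nat.cast_pow, ← mul_pow,
          ENNReal.mul_inv_cancel hc0 (ENNReal.natCast_ne_top _), one_pow, mul_one]

/-- The pointwise bound alone gives a deviation of order Θ^(-n), too weak against the weight (NΘ)^n.
Instead the deviation is summed through the recursion over levels, and the pointwise bound only
serves to kill the remainder. -/
theorem tsum_deviationAt_lt_top
    (hμ : ∀ w, μ (S.cell w) = ((Fintype.card ι : ℝ≥0∞)⁻¹) ^ w.length) (hN : 2 ≤ Fintype.card ι)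
    {Θ : ℝ} (hΘ : 1 < Θ) {a : List ι → ℝ} (ha : S.energy Θ a < ∞) {g : C(M, ℝ)} {C : ℝ}
    (h : ∀ w, ∀ x ∈ S.cell w, |g x - a w| ≤ C * (√Θ)⁻¹ ^ w.length) :
    ∑' n, ENNReal.ofReal (Fintype.card ι * Θ) ^ n * S.deviationAt μ g a n < ∞ := by
  set N : ℝ := ((Fintype.card ι : ℕ) : ℝ) with hNdef
  have hN2 : 2 ≤ N := by
    rw [hNdef]
    exact_mod_cast hN
  have hNE : (Fintype.card ι : ℝ≥0∞) = ENNReal.ofReal N := by rw [hNdef, ENNReal.ofReal_natCast]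
  have hΘ0 : 0 < Θ := by linarith
  -- The remainder after k steps is at most C² N^n ((1+ε)/Θ)^k, so 1 + ε < Θ is required.
  set ε := (Θ - 1) / 2 with hε
  have hε0 : 0 < ε := by rw [hε]; linarith
  have hεΘ : 1 + ε < Θ := by rw [hε]; linarith
  set κ := ENNReal.ofReal ((1 + ε) / (N * Θ)) with hκ
  have hκ1 : κ < 1 := by
    rw [hκ, ENNReal.ofReal_lt_one, div_lt_one (by positivity)]
    nlinarith
  have hinv : (ENNReal.ofReal N)⁻¹ = ENNReal.ofReal N⁻¹ := (ENNReal.ofReal_inv_of_pos (by linarith)).symm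
  refine (tsum_le_of_le_mul_succ_add (κ := κ)
    (E := fun n => ENNReal.ofReal (1 + ε⁻¹) * (ENNReal.ofReal Θ ^ n * S.energyAt a n))
    (fun n => ?_) (fun n => ?_)).trans_lt ?_
  · refine (mul_le_mul' le_rfl (S.deviationAt_le_succ hμ a g hε0 n)).trans ?_
    rw [mul_add, hNE, hinv]
    refine add_le_add ?_ ?_
    · rw [← mul_assoc, ← mul_assoc, hκ, ← ENNReal.ofReal_pow (by positivity),
        ← ENNReal.ofReal_pow (by positivity), ← ENNReal.ofReal_mul (by positivity),
        ← ENNReal.ofReal_mul (by positivity)]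
      gcongr ENNReal.ofReal ?_ * _
      rw [pow_succ]
      apply le_of_eq
      field_simp
    · rw [mul_left_comm, ← mul_assoc (ENNReal.ofReal (N * Θ) ^ n)]
      gcongr
      rw [← ENNReal.ofReal_pow (by positivity), ← ENNReal.ofReal_pow (by positivity),
        ← ENNReal.ofReal_pow (by positivity), ← ENNReal.ofReal_mul (by positivity)]
      apply ENNReal.ofReal_le_ofReal
      rw [pow_succ, ← mul_assoc, ← mul_pow, mul_comm N, mul_assoc, mul_inv_cancel₀ (by positivity),
        mul_one]
      exact mul_le_of_le_one_right (by positivity) (inv_le_one_of_one_le₀ (by linarith))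
  · have hlim : Tendsto (fun k : ℕ => ENNReal.ofReal (C ^ 2 * N ^ n * ((1 + ε) / Θ) ^ k)) atTop
        (nhds 0) := by
      rw [← ENNReal.ofReal_zero]
      refine ENNReal.tendsto_ofReal ?_
      simpa using (tendsto_pow_atTop_nhds_zero_of_lt_one (r := (1 + ε) / Θ) (by positivity)
        ((div_lt_one hΘ0).2 hεΘ)).const_mul (C ^ 2 * N ^ n)
    refine tendsto_of_tendsto_of_tendsto_of_le_of_le tendsto_const_nhds hlim
      (fun k => zero_le) fun k => ?_
    have hdev := S.deviationAt_le_of_abs_sub_le hμ hN (a := a) (g := g) (n := n + k)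
      (δ := C * (√Θ)⁻¹ ^ (n + k)) (fun w hw x hx => by rw [← hw]; exact h w x hx)
    refine (mul_le_mul' le_rfl (mul_le_mul' le_rfl hdev)).trans ?_
    rw [hκ, ← ENNReal.ofReal_pow (by positivity), ← ENNReal.ofReal_pow (by positivity),
      ← ENNReal.ofReal_mul (by positivity), ← ENNReal.ofReal_mul (by positivity)]
    apply ENNReal.ofReal_le_ofReal
    apply le_of_eq
    have hsq : ((√Θ)⁻¹ ^ (n + k)) ^ 2 = (Θ ^ (n + k))⁻¹ := by
      rw [← pow_mul, mul_comm, pow_mul, inv_pow, Real.sq_sqrt hΘ0.le, inv_pow]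
    rw [mul_pow C, hsq]
    simp only [pow_add, mul_pow, div_pow]
    field_simp
  · rw [ENNReal.tsum_mul_left]
    refine ENNReal.mul_lt_top (ENNReal.inv_lt_top.2 (tsub_pos_of_lt hκ1)) ?_
    exact ENNReal.mul_lt_top ENNReal.ofReal_lt_top ha

/-- Points closer than 2^(-(n+3)) lie in linked cells w, w' of level n. There g x - g y is split at
a w and a w', giving two deviations and one term of the energy. -/
theorem increment_le [IsFiniteMeasure μ]
    (hμ : ∀ w, μ (S.cell w) = ((Fintype.card ι : ℝ≥0∞)⁻¹) ^ w.length)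
    (a : List ι → ℝ) (g : C(M, ℝ)) (n : ℕ) :
    increment μ g ((1 / 2) ^ (n + 3)) ≤
      3 * ((2 * S.bound) * (((Fintype.card ι : ℝ≥0∞)⁻¹) ^ n * S.deviationAt μ g a n) +
        ((Fintype.card ι : ℝ≥0∞)⁻¹) ^ n * (((Fintype.card ι : ℝ≥0∞)⁻¹) ^ n * S.energyAt a n)) := by
  classical
  set q := ((Fintype.card ι : ℝ≥0∞)⁻¹) ^ n with hq
  have hg : ∀ w, Measurable fun x => ENNReal.ofReal ((g x - a w) ^ 2) := fun w => by
    have := g.continuous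
    exact (by fun_prop : Continuous fun x => (g x - a w) ^ 2).measurable.ennreal_ofReal
  set nb : List ι → Finset (List ι) := fun w => (words ι n).filter (· ∈ S.link w) with hnb
  have hnbcard : ∀ w, ((nb w).card : ℝ≥0∞) ≤ S.bound := fun w => by
    have : nb w ⊆ S.link w := fun v hv => (Finset.mem_filter.1 hv).2
    exact_mod_cast (Finset.card_le_card this).trans (S.card_link_le w)
  set ψ : List ι → ℝ≥0∞ := fun w => ∫⁻ x in S.cell w, ENNReal.ofReal ((g x - a w) ^ 2) ∂μ with hψ
  have hdouble : ∀ w ∈ words ι n, ∀ w' ∈ nb w,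
      ∫⁻ x in S.cell w, ∫⁻ y in S.cell w', ENNReal.ofReal ((g x - g y) ^ 2) ∂μ ∂μ ≤
        3 * (q * ψ w + q * (q * ENNReal.ofReal ((a w - a w') ^ 2)) + q * ψ w') := by
    intro w hw w' hw'
    have hμw : μ (S.cell w) = q := by rw [hμ, mem_words.1 hw]
    have hμw' : μ (S.cell w') = q := by rw [hμ, mem_words.1 (Finset.mem_filter.1 hw').1]
    have hinner : ∀ x, ∫⁻ y in S.cell w', ENNReal.ofReal ((g x - g y) ^ 2) ∂μ ≤
        3 * (q * ENNReal.ofReal ((g x - a w) ^ 2) + q * ENNReal.ofReal ((a w - a w') ^ 2) +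
          ψ w') := fun x => by
      refine (lintegral_mono fun y => ofReal_sq_sub_le (g x) (a w) (a w') (g y)).trans_eq ?_
      rw [lintegral_const_mul _ (by have := hg w'; fun_prop), lintegral_add_left measurable_const,
        setLIntegral_const, hμw', add_mul, mul_comm q, mul_comm q]
    refine (lintegral_mono hinner).trans_eq ?_
    rw [lintegral_const_mul _ (by have := hg w; fun_prop),
      lintegral_add_right _ measurable_const, lintegral_add_right _ measurable_const,
      lintegral_const_mul _ (hg w), setLIntegral_const, setLIntegral_const, hμw, mul_comm _ q,
      mul_comm _ q]
  calc increment μ g ((1 / 2) ^ (n + 3))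
      ≤ ∑ w ∈ words ι n, ∑ w' ∈ nb w,
          ∫⁻ x in S.cell w, ∫⁻ y in S.cell w', ENNReal.ofReal ((g x - g y) ^ 2) ∂μ ∂μ := by
        have hcov : (univ : Set M) ⊆ ⋃ w ∈ words ι n, S.cell w := fun x _ => by
          obtain ⟨w, hw, hx⟩ := S.exists_mem_words_cell n x
          exact mem_biUnion hw hx
        rw [increment, ← setLIntegral_univ]
        refine (setLIntegral_le_sum hcov _).trans (Finset.sum_le_sum fun w hw => ?_)
        rw [← lintegral_finsetSum _ fun w' _ => ?_]
        · refine setLIntegral_mono' (S.measurableSet_cell w) fun x hx => ?_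
          refine setLIntegral_le_sum (fun y hy => ?_) _
          obtain ⟨w', hw', hyw'⟩ := S.exists_mem_words_cell n y
          have hl : w' ∈ S.link w := S.mem_link_of_mem_cell
            (by rw [mem_words.1 hw, mem_words.1 hw']) hx hyw' (by rw [mem_words.1 hw]; exact hy)
          exact mem_biUnion (Finset.mem_coe.2 (Finset.mem_filter.2 ⟨hw', hl⟩)) hyw'
        · have hc : Continuous fun z : M × M => (g z.1 - g z.2) ^ 2 := by
            have := g.continuous
            fun_prop
          exact (hc.measurable.ennreal_ofReal).lintegral_prod_right'
    _ ≤ ∑ w ∈ words ι n, ∑ w' ∈ nb w,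
          3 * (q * ψ w + q * (q * ENNReal.ofReal ((a w - a w') ^ 2)) + q * ψ w') :=
        Finset.sum_le_sum fun w hw => Finset.sum_le_sum fun w' hw' => hdouble w hw w' hw'
    _ = 3 * ((∑ w ∈ words ι n, ∑ w' ∈ nb w, q * ψ w) +
          q * (q * ∑ w ∈ words ι n, ∑ w' ∈ nb w, ENNReal.ofReal ((a w - a w') ^ 2)) +
          ∑ w ∈ words ι n, ∑ w' ∈ nb w, q * ψ w') := by
        simp only [Finset.sum_add_distrib, Finset.mul_sum, mul_add]
    _ ≤ 3 * (S.bound * (q * S.deviationAt μ g a n) + q * (q * S.energyAt a n) +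
          S.bound * (q * S.deviationAt μ g a n)) := by
        have h1 : ∀ w, ∑ w' ∈ nb w, q * ψ w ≤ S.bound * (q * ψ w) := fun w => by
          rw [Finset.sum_const, nsmul_eq_mul]
          exact mul_le_mul' (hnbcard w) le_rfl
        gcongr
        · rw [deviationAt, Finset.mul_sum, Finset.mul_sum]
          exact Finset.sum_le_sum fun w _ => h1 w
        · rw [energyAt]
          exact Finset.sum_le_sum fun w _ => Finset.sum_le_sum_of_subset
            fun v hv => (Finset.mem_filter.1 hv).2
        -- The deviations on the second cell are counted by exchanging w and w', which is allowed
        -- since links of equal length are symmetric.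
        · rw [Finset.sum_comm' (t' := words ι n) (s' := nb), deviationAt, Finset.mul_sum,
            Finset.mul_sum]
          · exact Finset.sum_le_sum fun w _ => h1 w
          · intro w w'
            simp only [hnb, Finset.mem_filter]
            constructor
            · rintro ⟨h1, h2, h3⟩
              exact ⟨⟨h1, S.link_symm _ _ (by rw [mem_words.1 h1, mem_words.1 h2]) h3⟩, h2⟩
            · rintro ⟨⟨h1, h3⟩, h2⟩
              exact ⟨h1, h2, S.link_symm _ _ (by rw [mem_words.1 h1, mem_words.1 h2]) h3⟩
    _ = _ := by ring

/-- A continuous function which is the limit of a function of finite Besov energy on words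
belongs to the Besov space. -/
theorem mem_besov_of_energy_lt_top [IsProbabilityMeasure μ] {d β : ℝ}
    (hd : (2 : ℝ) ^ d = Fintype.card ι)
    (hμ : ∀ w, μ (S.cell w) = ((Fintype.card ι : ℝ≥0∞)⁻¹) ^ w.length) (hN : 2 ≤ Fintype.card ι)
    (hβ : d < β) {a : List ι → ℝ} (ha : S.energy (2 ^ (β - d)) a < ∞) {g : C(M, ℝ)} {C : ℝ}
    (h : ∀ w, ∀ x ∈ S.cell w, |g x - a w| ≤ C * (√(2 ^ (β - d)))⁻¹ ^ w.length)
    {u : Lp ℝ 2 μ} (hu : u =ᵐ[μ] g) : u ∈ besov μ d β := by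
  rw [mem_besov_iff hd]
  simp_rw [increment_congr hu]
  set Θ : ℝ := 2 ^ (β - d) with hΘ
  have hΘ1 : 1 < Θ := Real.one_lt_rpow one_lt_two (by linarith)
  set N : ℝ := ((Fintype.card ι : ℕ) : ℝ) with hNdef
  have hN2 : 2 ≤ N := by
    rw [hNdef]
    exact_mod_cast hN
  have hNE : (Fintype.card ι : ℝ≥0∞)⁻¹ = ENNReal.ofReal N⁻¹ := by
    rw [ENNReal.ofReal_inv_of_pos (by linarith), hNdef, ENNReal.ofReal_natCast]
  -- The estimate on increments starts at radius 2^(-3); the earlier terms are finite because g is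
  -- bounded.
  refine tsum_lt_top_of_shift 3 (fun n => ?_) ?_
  · refine ENNReal.mul_lt_top (ENNReal.pow_lt_top ENNReal.ofReal_lt_top) ?_
    obtain ⟨B, hB⟩ := (isCompact_univ (X := M)).exists_bound_of_continuousOn g.continuous.continuousOn
    have hle : ∀ x y, ENNReal.ofReal ((g x - g y) ^ 2) ≤ ENNReal.ofReal ((2 * B) ^ 2) :=
      fun x y => by
        apply ENNReal.ofReal_le_ofReal
        have h1 := abs_le.1 (hB x trivial)
        have h2 := abs_le.1 (hB y trivial)
        exact sq_le_sq' (by linarith [h1.1, h2.2]) (by linarith [h1.2, h2.1])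
    calc increment μ g ((1 / 2) ^ n)
        ≤ ∫⁻ _ : M, ∫⁻ _ : M, ENNReal.ofReal ((2 * B) ^ 2) ∂μ ∂μ :=
          lintegral_mono fun x => (setLIntegral_le_lintegral _ _).trans (lintegral_mono (hle x))
      _ < ∞ := by simp
  · have hW : ∀ n : ℕ, ENNReal.ofReal (N ^ 2 * Θ) ^ (n + 3) * increment μ g ((1 / 2) ^ (n + 3)) ≤
        ENNReal.ofReal (N ^ 2 * Θ) ^ 3 * (3 * ((2 * S.bound) *
          (ENNReal.ofReal (N * Θ) ^ n * S.deviationAt μ g a n) +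
          ENNReal.ofReal Θ ^ n * S.energyAt a n)) := fun n => by
      rw [pow_add, mul_comm (_ ^ n), mul_assoc]
      refine mul_le_mul' le_rfl ?_
      refine (mul_le_mul' le_rfl (S.increment_le hμ a g n)).trans_eq ?_
      rw [hNE]
      have e1 : ENNReal.ofReal (N ^ 2 * Θ) ^ n * ENNReal.ofReal N⁻¹ ^ n =
          ENNReal.ofReal (N * Θ) ^ n := by
        rw [← mul_pow, ← ENNReal.ofReal_mul (by positivity)]
        congr 2
        field_simp
      have e2 : ENNReal.ofReal (N * Θ) ^ n * ENNReal.ofReal N⁻¹ ^ n = ENNReal.ofReal Θ ^ n := by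
        rw [← mul_pow, ← ENNReal.ofReal_mul (by positivity)]
        congr 2
        field_simp
      rw [← e2, ← e1]
      ring
    refine (ENNReal.tsum_le_tsum hW).trans_lt ?_
    rw [ENNReal.tsum_mul_left, ENNReal.tsum_mul_left, ENNReal.tsum_add, ENNReal.tsum_mul_left]
    refine ENNReal.mul_lt_top (ENNReal.pow_lt_top ENNReal.ofReal_lt_top)
      (ENNReal.mul_lt_top (by simp) (ENNReal.add_lt_top.2 ⟨ENNReal.mul_lt_top
        (ENNReal.mul_lt_top (by simp) (by simp)) ?_, ha⟩))
    exact S.tsum_deviationAt_lt_top hμ hN hΘ1 ha h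

end HalfSystem

/-! ### From the Besov space to finite discrete energy: cell averages -/

theorem ofReal_sq_integral_sub_le {X : Type*} [MeasurableSpace X] {ν : Measure X}
    [IsProbabilityMeasure ν] {f : X → ℝ} (hf : MemLp f 2 ν) (c : ℝ) :
    ENNReal.ofReal ((∫ x, f x ∂ν - c) ^ 2) ≤ ∫⁻ x, ENNReal.ofReal ((f x - c) ^ 2) ∂ν := by
  have hfc : MemLp (fun x => f x - c) 2 ν := hf.sub (memLp_const c)
  have h1 : ∫ x, (f x - c) ∂ν = ∫ x, f x ∂ν - c := by
    rw [integral_sub (hf.integrable (by norm_num)) (integrable_const c)]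
    simp
  -- Jensen's inequality for the square, in the form that the variance of f - c is nonnegative.
  have h2 := ProbabilityTheory.variance_nonneg (fun x => f x - c) ν
  rw [ProbabilityTheory.variance_eq_sub hfc, h1] at h2
  rw [← ofReal_integral_eq_lintegral_ofReal hfc.integrable_sq
    (Eventually.of_forall fun x => sq_nonneg _)]
  exact ENNReal.ofReal_le_ofReal (by simpa using h2)

theorem ofReal_sq_sub_le_two (p q r : ℝ) : ENNReal.ofReal ((p - q) ^ 2) ≤
    2 * ENNReal.ofReal ((p - r) ^ 2) + 2 * ENNReal.ofReal ((q - r) ^ 2) := by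
  rw [← ENNReal.ofReal_ofNat, ← ENNReal.ofReal_mul two_pos.le, ← ENNReal.ofReal_mul two_pos.le,
    ← ENNReal.ofReal_add (by positivity) (by positivity)]
  exact ENNReal.ofReal_le_ofReal (by nlinarith [sq_nonneg ((p - r) + (q - r))])

theorem increment_lt_top {M : Type} [MetricSpace M] [MeasurableSpace M] {μ : Measure M}
    [IsProbabilityMeasure μ] {f : M → ℝ} (hm : Measurable f) (hf : MemLp f 2 μ) (r : ℝ) :
    increment μ f r < ∞ := by
  have hi : ∫⁻ x, ENNReal.ofReal (f x ^ 2) ∂μ < ∞ := by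
    rw [← ofReal_integral_eq_lintegral_ofReal hf.integrable_sq
      (Eventually.of_forall fun x => sq_nonneg _)]
    exact ENNReal.ofReal_lt_top
  have hle : ∀ x y, ENNReal.ofReal ((f x - f y) ^ 2) ≤
      2 * ENNReal.ofReal (f x ^ 2) + 2 * ENNReal.ofReal (f y ^ 2) := fun x y => by
    simpa using ofReal_sq_sub_le_two (f x) (f y) 0
  have hm2 : Measurable fun x => ENNReal.ofReal (f x ^ 2) := by fun_prop
  calc increment μ f r
      ≤ ∫⁻ x, ∫⁻ y, (2 * ENNReal.ofReal (f x ^ 2) + 2 * ENNReal.ofReal (f y ^ 2)) ∂μ ∂μ :=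
        lintegral_mono fun x => (setLIntegral_le_lintegral _ _).trans (lintegral_mono (hle x))
    _ = 2 * ∫⁻ x, ENNReal.ofReal (f x ^ 2) ∂μ + 2 * ∫⁻ x, ENNReal.ofReal (f x ^ 2) ∂μ := by
        simp_rw [lintegral_add_left measurable_const, lintegral_const_mul _ hm2]
        rw [lintegral_add_right _ measurable_const]
        simp [lintegral_const_mul _ hm2]
    _ < ∞ := ENNReal.add_lt_top.2 ⟨ENNReal.mul_lt_top (by simp) hi, ENNReal.mul_lt_top (by simp) hi⟩

/-- The radius 8 · 2^(-n) is the one within which linked cells lie; as 8 = 2³ it costs a shift by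
three levels. -/
theorem tsum_increment_lt_top {M : Type} [MetricSpace M] [MeasurableSpace M] {μ : Measure M}
    [IsProbabilityMeasure μ] {N : ℕ} {d β : ℝ} (hd : (2 : ℝ) ^ d = N)
    {u : Lp ℝ 2 μ} (hu : u ∈ besov μ d β) :
    ∑' n, ENNReal.ofReal (N ^ 2 * 2 ^ (β - d)) ^ n *
      increment μ u (8 * (1 / 2) ^ n) < ∞ := by
  rw [mem_besov_iff hd] at hu
  refine tsum_lt_top_of_shift 3 (fun n => ENNReal.mul_lt_top
    (ENNReal.pow_lt_top ENNReal.ofReal_lt_top)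
    (increment_lt_top (Lp.stronglyMeasurable u).measurable (Lp.memLp u) _)) ?_
  have h8 : ∀ n : ℕ, (8 : ℝ) * (1 / 2) ^ (n + 3) = (1 / 2) ^ n := fun n => by
    rw [pow_add]
    ring
  simp_rw [h8, pow_add, mul_comm (_ ^ _) (_ ^ 3), mul_assoc]
  rw [ENNReal.tsum_mul_left]
  exact ENNReal.mul_lt_top (ENNReal.pow_lt_top ENNReal.ofReal_lt_top) hu

namespace HalfSystem

variable {ι : Type} [Fintype ι] {M : Type} [MetricSpace M] (S : HalfSystem ι M)
  [MeasurableSpace M] {μ : Measure M}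

/-- The average of a function over the cell of a word. -/
noncomputable def cellAverage (μ : Measure M) (f : M → ℝ) (w : List ι) : ℝ :=
  ∫ x, f x ∂(ProbabilityTheory.cond μ (S.cell w))

theorem isProbabilityMeasure_cond_cell [IsFiniteMeasure μ]
    (hμ : ∀ w, μ (S.cell w) = ((Fintype.card ι : ℝ≥0∞)⁻¹) ^ w.length) (w : List ι) :
    IsProbabilityMeasure (ProbabilityTheory.cond μ (S.cell w)) := by
  refine ProbabilityTheory.cond_isProbabilityMeasure ?_
  rw [hμ]
  exact (ENNReal.pow_pos (ENNReal.inv_pos.2 (ENNReal.natCast_ne_top _)) _).ne'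

theorem memLp_cond_cell
    (hμ : ∀ w, μ (S.cell w) = ((Fintype.card ι : ℝ≥0∞)⁻¹) ^ w.length) {f : M → ℝ}
    (hf : MemLp f 2 μ) (w : List ι) : MemLp f 2 (ProbabilityTheory.cond μ (S.cell w)) := by
  refine (hf.restrict _).smul_measure ?_
  rw [hμ]
  exact ENNReal.inv_ne_top.2
    (ENNReal.pow_pos (ENNReal.inv_pos.2 (ENNReal.natCast_ne_top _)) _).ne'

theorem lintegral_cond_cell
    (hμ : ∀ w, μ (S.cell w) = ((Fintype.card ι : ℝ≥0∞)⁻¹) ^ w.length) (w : List ι)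
    (G : M → ℝ≥0∞) : ∫⁻ x, G x ∂(ProbabilityTheory.cond μ (S.cell w)) =
      (Fintype.card ι : ℝ≥0∞) ^ w.length * ∫⁻ x in S.cell w, G x ∂μ := by
  rw [ProbabilityTheory.cond, lintegral_smul_measure, hμ, smul_eq_mul, ← ENNReal.inv_pow, inv_inv]

theorem ofReal_sq_cellAverage_sub_le [IsFiniteMeasure μ]
    (hμ : ∀ w, μ (S.cell w) = ((Fintype.card ι : ℝ≥0∞)⁻¹) ^ w.length) {f : M → ℝ}
    (hf : MemLp f 2 μ) (w : List ι) (c : ℝ) :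
    ENNReal.ofReal ((S.cellAverage μ f w - c) ^ 2) ≤
      (Fintype.card ι : ℝ≥0∞) ^ w.length *
        ∫⁻ x in S.cell w, ENNReal.ofReal ((f x - c) ^ 2) ∂μ := by
  have := S.isProbabilityMeasure_cond_cell hμ w
  rw [← S.lintegral_cond_cell hμ]
  exact ofReal_sq_integral_sub_le (S.memLp_cond_cell hμ hf w) c

/-- Jensen's inequality applied twice, once in each cell. -/
theorem ofReal_sq_cellAverage_sub_cellAverage_le [IsFiniteMeasure μ]
    (hμ : ∀ w, μ (S.cell w) = ((Fintype.card ι : ℝ≥0∞)⁻¹) ^ w.length) {f : M → ℝ}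
    (hf : MemLp f 2 μ) (w w' : List ι) :
    ENNReal.ofReal ((S.cellAverage μ f w - S.cellAverage μ f w') ^ 2) ≤
      (Fintype.card ι : ℝ≥0∞) ^ w.length * ((Fintype.card ι : ℝ≥0∞) ^ w'.length *
        ∫⁻ x in S.cell w, ∫⁻ y in S.cell w', ENNReal.ofReal ((f x - f y) ^ 2) ∂μ ∂μ) := by
  refine (S.ofReal_sq_cellAverage_sub_le hμ hf w _).trans (mul_le_mul' le_rfl ?_)
  rw [← lintegral_const_mul' _ _ (ENNReal.pow_ne_top (ENNReal.natCast_ne_top _))]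
  refine lintegral_mono fun x => ?_
  have h := S.ofReal_sq_cellAverage_sub_le hμ hf w' (f x)
  simp_rw [sub_sq_comm _ (f x)] at h
  exact h

variable [BorelSpace M] [CompactSpace M]

/-- Bounded overlap: all level-n cells containing a point are linked to any one of them, so there
are at most `S.bound` of them. -/
theorem sum_setLIntegral_cell_le (n : ℕ) (G : M → ℝ≥0∞) :
    ∑ w ∈ words ι n, ∫⁻ x in S.cell w, G x ∂μ ≤ S.bound * ∫⁻ x, G x ∂μ := by
  classical
  rw [← lintegral_finsetSum_measure, ← smul_eq_mul, ← lintegral_smul_measure]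
  refine lintegral_mono' (Measure.le_iff.2 fun t ht => ?_) le_rfl
  rw [Measure.finsetSum_apply]
  calc ∑ w ∈ words ι n, μ.restrict (S.cell w) t
      = ∑ w ∈ words ι n, ∫⁻ x in t, (S.cell w).indicator 1 x ∂μ := by
        refine Finset.sum_congr rfl fun w _ => ?_
        rw [lintegral_indicator_one (S.measurableSet_cell w),
          Measure.restrict_apply ht, Measure.restrict_apply (S.measurableSet_cell w), inter_comm]
    _ = ∫⁻ x in t, ∑ w ∈ words ι n, (S.cell w).indicator 1 x ∂μ := by
        rw [lintegral_finsetSum]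
        exact fun w _ => measurable_one.indicator (S.measurableSet_cell w)
    _ ≤ ∫⁻ x in t, S.bound ∂μ := by
        refine lintegral_mono fun x => ?_
        obtain ⟨w₀, hw₀, hx₀⟩ := S.exists_mem_words_cell n x
        have : ∀ w ∈ words ι n, (S.cell w).indicator (1 : M → ℝ≥0∞) x ≤
            if w ∈ S.link w₀ then 1 else 0 := fun w hw => by
          by_cases hx : x ∈ S.cell w
          · have hl := S.mem_link_of_mem_cell_inter
              (by rw [mem_words.1 hw₀, mem_words.1 hw]) hx₀ hx
            simp [hl, hx]
          · simp [hx]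
        refine (Finset.sum_le_sum this).trans ?_
        rw [Finset.sum_boole]
        exact_mod_cast (Finset.card_le_card
          (fun v hv => (Finset.mem_filter.1 hv).2)).trans (S.card_link_le w₀)
    _ = _ := by simp

theorem sum_sum_setLIntegral_le (n : ℕ) (f : M → ℝ) :
    ∑ w ∈ words ι n, ∑ w' ∈ S.link w,
      ∫⁻ x in S.cell w, ∫⁻ y in S.cell w', ENNReal.ofReal ((f x - f y) ^ 2) ∂μ ∂μ ≤
      S.bound ^ 2 * increment μ f (8 * (1 / 2) ^ n) := by
  set G : M → ℝ≥0∞ := fun x =>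
    ∫⁻ y in {y | dist x y < 8 * (1 / 2) ^ n}, ENNReal.ofReal ((f x - f y) ^ 2) ∂μ with hG
  calc _ ≤ ∑ w ∈ words ι n, ∑ w' ∈ S.link w, ∫⁻ x in S.cell w, G x ∂μ := by
        refine Finset.sum_le_sum fun w hw => Finset.sum_le_sum fun w' hw' => ?_
        refine setLIntegral_mono' (S.measurableSet_cell w) fun x hx => ?_
        refine lintegral_mono_set fun y hy => ?_
        have := S.dist_lt_of_mem_cell hw' hx hy
        rwa [mem_words.1 hw] at this
    _ ≤ ∑ w ∈ words ι n, S.bound * ∫⁻ x in S.cell w, G x ∂μ := by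
        refine Finset.sum_le_sum fun w _ => ?_
        rw [Finset.sum_const, nsmul_eq_mul]
        exact mul_le_mul' (by exact_mod_cast S.card_link_le w) le_rfl
    _ ≤ S.bound * (S.bound * ∫⁻ x, G x ∂μ) := by
        rw [← Finset.mul_sum]
        exact mul_le_mul' le_rfl (S.sum_setLIntegral_cell_le n G)
    _ = _ := by rw [sq, mul_assoc, increment]

variable [IsProbabilityMeasure μ]

/-- Averaging over w and w' costs N^n and at most N^(n+1), since w' may be a child. One factor
`S.bound` counts the links of a cell, the other the overlap of cells. -/
theorem energyAt_cellAverage_le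
    (hμ : ∀ w, μ (S.cell w) = ((Fintype.card ι : ℝ≥0∞)⁻¹) ^ w.length)
    (hN : 2 ≤ Fintype.card ι) {f : M → ℝ} (hf : MemLp f 2 μ) (n : ℕ) :
    S.energyAt (S.cellAverage μ f) n ≤ (Fintype.card ι * S.bound ^ 2) *
      (((Fintype.card ι : ℝ≥0∞) ^ 2) ^ n * increment μ f (8 * (1 / 2) ^ n)) := by
  have hN1 : (1 : ℝ≥0∞) ≤ Fintype.card ι := by exact_mod_cast le_trans one_le_two hN
  calc S.energyAt (S.cellAverage μ f) n
      ≤ ∑ w ∈ words ι n, ∑ w' ∈ S.link w, ((Fintype.card ι : ℝ≥0∞) ^ n *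
          (Fintype.card ι : ℝ≥0∞) ^ (n + 1)) *
          ∫⁻ x in S.cell w, ∫⁻ y in S.cell w', ENNReal.ofReal ((f x - f y) ^ 2) ∂μ ∂μ := by
        refine Finset.sum_le_sum fun w hw => Finset.sum_le_sum fun w' hw' => ?_
        refine (S.ofReal_sq_cellAverage_sub_cellAverage_le hμ hf w w').trans ?_
        rw [mul_assoc, mem_words.1 hw]
        refine mul_le_mul' le_rfl (mul_le_mul' (pow_le_pow_right' hN1 ?_) le_rfl)
        have := S.length_le w w' hw'
        rwa [mem_words.1 hw] at this
    _ ≤ ((Fintype.card ι : ℝ≥0∞) ^ n * (Fintype.card ι : ℝ≥0∞) ^ (n + 1)) *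
          (S.bound ^ 2 * increment μ f (8 * (1 / 2) ^ n)) := by
        simp_rw [← Finset.mul_sum]
        exact mul_le_mul' le_rfl (S.sum_sum_setLIntegral_le n f)
    _ = _ := by ring

theorem energy_cellAverage_lt_top {d β : ℝ} (hd : (2 : ℝ) ^ d = Fintype.card ι)
    (hμ : ∀ w, μ (S.cell w) = ((Fintype.card ι : ℝ≥0∞)⁻¹) ^ w.length) (hN : 2 ≤ Fintype.card ι)
    {u : Lp ℝ 2 μ} (hu : u ∈ besov μ d β) :
    S.energy (2 ^ (β - d)) (S.cellAverage μ u) < ∞ := by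
  have hle : ∀ n, ENNReal.ofReal (2 ^ (β - d)) ^ n * S.energyAt (S.cellAverage μ u) n ≤
      (Fintype.card ι * S.bound ^ 2) * (ENNReal.ofReal (Fintype.card ι ^ 2 * 2 ^ (β - d)) ^ n *
      increment μ u (8 * (1 / 2) ^ n)) := fun n => by
    refine (mul_le_mul' le_rfl (S.energyAt_cellAverage_le hμ hN (Lp.memLp u) n)).trans_eq ?_
    rw [ENNReal.ofReal_mul (by positivity), ENNReal.ofReal_pow (by positivity),
      ENNReal.ofReal_natCast]
    ring
  refine (ENNReal.tsum_le_tsum hle).trans_lt ?_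
  rw [ENNReal.tsum_mul_left]
  exact ENNReal.mul_lt_top (ENNReal.mul_lt_top (ENNReal.natCast_lt_top _)
    (ENNReal.pow_lt_top (ENNReal.natCast_lt_top _))) (tsum_increment_lt_top hd hu)

/-- Both u and g approach the cell averages in mean square: u because its deviation is bounded by
the terms of a convergent Besov series, g by uniform convergence. Hence the integral of (u - g)² is
zero. -/
theorem ae_eq_of_tracks_cellAverage [Nonempty M] {d β : ℝ} (hd : (2 : ℝ) ^ d = Fintype.card ι)
    (hμ : ∀ w, μ (S.cell w) = ((Fintype.card ι : ℝ≥0∞)⁻¹) ^ w.length) (hN : 2 ≤ Fintype.card ι)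
    (hβ : d < β) {u : Lp ℝ 2 μ} (hu : u ∈ besov μ d β) {g : C(M, ℝ)}
    (hg : S.Tracks g (S.cellAverage μ u)) : u =ᵐ[μ] g := by
  have hum := (Lp.stronglyMeasurable u).measurable
  have hN1 : (1 : ℝ) ≤ Fintype.card ι := by exact_mod_cast le_trans one_le_two hN
  set a := S.cellAverage μ u with ha
  set W := ENNReal.ofReal (Fintype.card ι ^ 2 * 2 ^ (β - d)) with hW
  -- The deviation only needs the weight N^n, so there is room to replace it by the larger W^n,
  -- whose series is known to converge.
  have hNW : (Fintype.card ι : ℝ≥0∞) ≤ W := by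
    rw [← ENNReal.ofReal_natCast, hW]
    apply ENNReal.ofReal_le_ofReal
    have : (1 : ℝ) ≤ 2 ^ (β - d) := Real.one_le_rpow one_le_two (by linarith)
    nlinarith [mul_nonneg (by positivity : (0 : ℝ) ≤ (Fintype.card ι : ℝ) ^ 2) (sub_nonneg.2 this)]
  have hdev : ∀ n, S.deviationAt μ u a n ≤
      S.bound ^ 2 * (W ^ n * increment μ u (8 * (1 / 2) ^ n)) := fun n => by
    calc S.deviationAt μ u a n
        ≤ ∑ w ∈ words ι n, (Fintype.card ι : ℝ≥0∞) ^ n * ∫⁻ x in S.cell w,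
            ∫⁻ y in S.cell w, ENNReal.ofReal ((u x - u y) ^ 2) ∂μ ∂μ := by
          refine Finset.sum_le_sum fun w hw => ?_
          rw [← lintegral_const_mul' _ _ (ENNReal.pow_ne_top (ENNReal.natCast_ne_top _))]
          refine lintegral_mono fun x => ?_
          have h := S.ofReal_sq_cellAverage_sub_le hμ (Lp.memLp u) w (u x)
          simp_rw [sub_sq_comm _ (u x), mem_words.1 hw] at h
          exact h
      _ ≤ (Fintype.card ι : ℝ≥0∞) ^ n * ∑ w ∈ words ι n, ∑ w' ∈ S.link w, ∫⁻ x in S.cell w,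
            ∫⁻ y in S.cell w', ENNReal.ofReal ((u x - u y) ^ 2) ∂μ ∂μ := by
          rw [Finset.mul_sum]
          refine Finset.sum_le_sum fun w hw => mul_le_mul' le_rfl ?_
          obtain ⟨x⟩ := ‹Nonempty M›
          have hself : w ∈ S.link w :=
            S.mem_link_of_mem_cell_inter rfl (mem_range_self x) (mem_range_self x)
          exact Finset.single_le_sum (f := fun w' => ∫⁻ x in S.cell w,
            ∫⁻ y in S.cell w', ENNReal.ofReal ((u x - u y) ^ 2) ∂μ ∂μ) (fun _ _ => zero_le) hself
      _ ≤ W ^ n * (S.bound ^ 2 * increment μ u (8 * (1 / 2) ^ n)) :=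
          mul_le_mul' (pow_le_pow_left' hNW n) (S.sum_sum_setLIntegral_le n u)
      _ = _ := mul_left_comm _ _ _
  have hdev0 : Tendsto (fun n => S.deviationAt μ u a n) atTop (nhds 0) := by
    have h := ENNReal.Tendsto.const_mul (a := (S.bound : ℝ≥0∞) ^ 2)
      (ENNReal.tendsto_atTop_zero_of_tsum_ne_top (tsum_increment_lt_top hd hu).ne)
      (Or.inr (ENNReal.pow_ne_top (ENNReal.natCast_ne_top _)))
    rw [mul_zero] at h
    exact tendsto_of_tendsto_of_tendsto_of_le_of_le tendsto_const_nhds h (fun n => zero_le) hdev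
  have hsplit : ∀ n, ∫⁻ x, ENNReal.ofReal ((u x - g x) ^ 2) ∂μ ≤
      2 * S.deviationAt μ u a n + 2 * S.deviationAt μ g a n := fun n => by
    have hcov : (univ : Set M) ⊆ ⋃ w ∈ words ι n, S.cell w := fun x _ => by
      obtain ⟨w, hw, hx⟩ := S.exists_mem_words_cell n x
      exact mem_biUnion hw hx
    rw [← setLIntegral_univ]
    refine (setLIntegral_le_sum hcov _).trans ?_
    rw [deviationAt, deviationAt, Finset.mul_sum, Finset.mul_sum, ← Finset.sum_add_distrib]
    refine Finset.sum_le_sum fun w _ => ?_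
    have hm1 : Measurable fun x => ENNReal.ofReal ((u x - a w) ^ 2) := by fun_prop
    have hm2 : Measurable fun x => ENNReal.ofReal ((g x - a w) ^ 2) := by
      have := g.continuous.measurable
      fun_prop
    rw [← lintegral_const_mul _ hm1, ← lintegral_const_mul _ hm2,
      ← lintegral_add_left (hm1.const_mul _)]
    exact lintegral_mono fun x => ofReal_sq_sub_le_two (u x) (g x) (a w)
  have hzero : ∫⁻ x, ENNReal.ofReal ((u x - g x) ^ 2) ∂μ = 0 := by
    refine le_antisymm (ENNReal.le_of_forall_pos_le_add fun ε hε _ => ?_) zero_le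
    have h1 := (ENNReal.Tendsto.const_mul hdev0 (Or.inr ENNReal.ofNat_ne_top) (a := 2))
    rw [mul_zero] at h1
    have hε2 : (0 : ℝ) < ε / 2 := by positivity
    obtain ⟨n₀, hn₀⟩ := hg √(ε / 4) (by positivity)
    obtain ⟨n, hn, hn'⟩ := ((h1.eventually_le_const (v := 0)
      (u := ENNReal.ofReal (ε / 2)) (by simpa using hε)).and (eventually_ge_atTop n₀)).exists
    have h2 := S.deviationAt_le_of_abs_sub_le hμ hN (a := a) (g := g) (n := n)
      (fun w hw x hx => hn₀ w (by omega) x hx)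
    rw [Real.sq_sqrt (by positivity)] at h2
    rw [zero_add]
    calc _ ≤ _ := hsplit n
      _ ≤ ENNReal.ofReal (ε / 2) + 2 * ENNReal.ofReal (ε / 4) := by gcongr
      _ = ENNReal.ofReal ε := by
        rw [← ENNReal.ofReal_ofNat, ← ENNReal.ofReal_mul two_pos.le,
          ← ENNReal.ofReal_add (by positivity) (by positivity)]
        congr 1
        ring
      _ = ε := ENNReal.ofReal_coe_nnreal
  have hmeas : Measurable fun x => ENNReal.ofReal ((u x - g x) ^ 2) := by
    have := g.continuous.measurable
    fun_prop
  rw [lintegral_eq_zero_iff hmeas] at hzero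
  filter_upwards [hzero] with x hx
  have : (u x - g x) ^ 2 ≤ 0 := ENNReal.ofReal_eq_zero.1 hx
  exact sub_eq_zero.1 (pow_eq_zero_iff two_ne_zero |>.1 (le_antisymm this (sq_nonneg _)))

end HalfSystem

/-! ### Subsystems -/

namespace HalfSystem

variable {ι : Type} {M : Type}

/-- The composition of maps along a word. -/
def compose (f : ι → M → M) : List ι → M → M
  | [], x => x
  | i :: w, x => compose f w (f i x)

variable [Fintype ι] [MetricSpace M]

/-- The self-similar system induced on an isometrically embedded space which is invariant under
some of the maps. -/
noncomputable def sub (S : HalfSystem ι M) {ι' : Type} [Fintype ι'] {M' : Type} [MetricSpace M']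
    {φ : M' → M} (hφ : Isometry φ) {j : ι' → ι} (hj : Function.Injective j) (f : ι' → M' → M')
    (hf : ∀ i x, φ (f i x) = S.map (j i) (φ x)) (hcover : ∀ x, ∃ i y, f i y = x)
    (hcomp : ∀ w x, φ (compose f w x) = S.comp (w.map j) (φ x)) : HalfSystem ι' M' where
  map := f
  dist_map i x y := by rw [← hφ.dist_eq, hf, hf, S.dist_map, hφ.dist_eq]
  cover := hcover
  comp := compose f
  comp_nil _ := rfl
  comp_cons _ _ _ := rfl
  link w := (S.link (w.map j)).preimage (List.map j) hj.list_map.injOn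
  bound := S.bound
  card_link_le w := (Finset.card_le_card_of_injOn (List.map j)
    (fun v hv => Finset.mem_preimage.1 hv) hj.list_map.injOn).trans (S.card_link_le _)
  cons_mem_link i w := Finset.mem_preimage.2 (S.cons_mem_link (j i) (w.map j))
  length_le w w' h := by simpa using S.length_le _ _ (Finset.mem_preimage.1 h)
  link_symm w w' h h' := Finset.mem_preimage.2
    (S.link_symm _ _ (by simpa using h) (Finset.mem_preimage.1 h'))
  mem_link w w' x y h h' := Finset.mem_preimage.2
    (S.mem_link _ _ (φ x) (φ y) (by simpa using h) (by
      rwa [← hcomp, ← hcomp, hφ.dist_eq, List.length_map]))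
  dist_lt_of_mem_link w w' h x y := by
    have := S.dist_lt_of_mem_link _ _ (Finset.mem_preimage.1 h) (φ x) (φ y)
    rwa [← hcomp, ← hcomp, hφ.dist_eq, List.length_map] at this

end HalfSystem

/-! ### The gasket as a self-similar system -/

/-- First affine coordinate of the plane with respect to the vertices of the gasket. -/
noncomputable def coordA (x : Plane) : ℝ := x 0 - x 1 / √3

/-- Second affine coordinate of the plane with respect to the vertices of the gasket. -/
noncomputable def coordB (x : Plane) : ℝ := 2 * (x 1 / √3)

/-- The first coordinates of the vertices. -/
def vertexA : Fin 3 → ℤ := ![0, 1, 0]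

/-- The second coordinates of the vertices. -/
def vertexB : Fin 3 → ℤ := ![0, 0, 1]

/-- The integral coordinate of a cell. -/
def position (e : Fin 3 → ℤ) : List (Fin 3) → ℤ
  | [] => 0
  | i :: w => 2 * position e w + e i

theorem continuous_coordA : Continuous coordA := by
  unfold coordA
  fun_prop

theorem continuous_coordB : Continuous coordB := by
  unfold coordB
  fun_prop

theorem coordA_vertex (i : Fin 3) : coordA (vertex i) = vertexA i := by
  have h3 : √3 ≠ 0 := by positivity
  fin_cases i <;> simp [coordA, vertex, vertexA]
  field_simp
  norm_num

theorem coordB_vertex (i : Fin 3) : coordB (vertex i) = vertexB i := by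
  have h3 : √3 ≠ 0 := by positivity
  fin_cases i <;> simp [coordB, vertex, vertexB]
  field_simp

theorem coordA_contraction (i : Fin 3) (x : Plane) :
    coordA (contraction i x) = (coordA x + vertexA i) / 2 := by
  rw [← coordA_vertex]
  simp only [coordA, contraction, PiLp.smul_apply, PiLp.add_apply, smul_eq_mul]
  ring

theorem coordB_contraction (i : Fin 3) (x : Plane) :
    coordB (contraction i x) = (coordB x + vertexB i) / 2 := by
  rw [← coordB_vertex]
  simp only [coordB, contraction, PiLp.smul_apply, PiLp.add_apply, smul_eq_mul]
  ring

/-- With a and b the differences of the two affine coordinates, the squared distance is a² + ab +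
b², which is at most (|a| + |b|)². -/
theorem dist_le_abs_coord (x y : Plane) :
    dist x y ≤ |coordA x - coordA y| + |coordB x - coordB y| := by
  have h3 : √3 ^ 2 = 3 := Real.sq_sqrt (by norm_num)
  have h0 : (0 : ℝ) < √3 := by positivity
  have e0 : x 0 - y 0 = (coordA x - coordA y) + (coordB x - coordB y) / 2 := by
    simp only [coordA, coordB]
    ring
  have e1 : x 1 - y 1 = √3 * ((coordB x - coordB y) / 2) := by
    simp only [coordB]
    field_simp
  rw [EuclideanSpace.dist_eq, Fin.sum_univ_two, Real.dist_eq, Real.dist_eq, sq_abs, sq_abs, e0, e1]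
  refine Real.sqrt_le_iff.2 ⟨by positivity, ?_⟩
  rw [mul_pow, h3]
  generalize coordA x - coordA y = a
  generalize coordB x - coordB y = b
  have h1 := sq_abs a
  have h2 := sq_abs b
  have h4 := le_abs_self (a * b)
  rw [abs_mul] at h4
  nlinarith [abs_nonneg a, abs_nonneg b, mul_nonneg (abs_nonneg a) (abs_nonneg b)]

theorem abs_coord_sub_le (x y : Plane) : |coordA x - coordA y| ≤ 2 * dist x y ∧
    |coordB x - coordB y| ≤ 2 * dist x y ∧
    |(coordA x + coordB x) - (coordA y + coordB y)| ≤ 2 * dist x y := by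
  have h0 : |x 0 - y 0| ≤ dist x y := by
    have := PiLp.norm_apply_le (x - y) 0
    rwa [← dist_eq_norm] at this
  have h1 : |x 1 - y 1| ≤ dist x y := by
    have := PiLp.norm_apply_le (x - y) 1
    rwa [← dist_eq_norm] at this
  have h3 : (1 : ℝ) ≤ √3 := Real.one_le_sqrt.2 (by norm_num)
  have h2 : |x 1 / √3 - y 1 / √3| ≤ dist x y := by
    rw [← sub_div, abs_div, abs_of_pos (by positivity : 0 < √3)]
    exact (div_le_self (abs_nonneg _) h3).trans h1
  rw [abs_le] at h0 h2
  simp only [coordA, coordB, abs_le]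
  refine ⟨⟨?_, ?_⟩, ⟨?_, ?_⟩, ?_, ?_⟩ <;> linarith [h0.1, h0.2, h2.1, h2.2]

theorem coord_mem_of_mem_gasket {x : Plane} (hx : x ∈ gasket) :
    0 ≤ coordA x ∧ 0 ≤ coordB x ∧ coordA x + coordB x ≤ 1 := by
  have hclosed : IsClosed {x : Plane | 0 ≤ coordA x ∧ 0 ≤ coordB x ∧ coordA x + coordB x ≤ 1} :=
    (isClosed_le continuous_const continuous_coordA).inter
      ((isClosed_le continuous_const continuous_coordB).inter
        (isClosed_le (continuous_coordA.add continuous_coordB) continuous_const))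
  have hlevel : ∀ n, level n ⊆
      {x : Plane | 0 ≤ coordA x ∧ 0 ≤ coordB x ∧ coordA x + coordB x ≤ 1} := by
    intro n
    induction n with
    | zero =>
      rintro _ ⟨i, rfl⟩
      simp only [mem_ofPred_eq, coordA_vertex, coordB_vertex]
      fin_cases i <;> simp [vertexA, vertexB]
    | succ n ih =>
      intro x hx
      obtain ⟨i, y, hy, rfl⟩ := mem_iUnion.1 hx
      obtain ⟨h1, h2, h3⟩ := ih hy
      simp only [mem_ofPred_eq, coordA_contraction, coordB_contraction]
      fin_cases i <;> simp [vertexA, vertexB] <;> refine ⟨?_, ?_, ?_⟩ <;> linarith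
  exact closure_minimal (iUnion_subset hlevel) hclosed hx

theorem contraction_mem_gasket (i : Fin 3) {x : Plane} (hx : x ∈ gasket) :
    contraction i x ∈ gasket := by
  rw [gasket_eq]
  exact mem_iUnion.2 ⟨i, x, hx, rfl⟩

/-- The contractions as maps of the gasket. -/
noncomputable def gasketMap (i : Fin 3) (x : gasket) : gasket :=
  ⟨contraction i x, contraction_mem_gasket i x.2⟩

theorem dist_gasketMap (i : Fin 3) (x y : gasket) :
    dist (gasketMap i x) (gasketMap i y) = 1 / 2 * dist x y :=
  dist_contraction i x y

theorem gasketMap_cover (x : gasket) : ∃ i y, gasketMap i y = x := by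
  obtain ⟨i, y, hy, h⟩ := mem_iUnion.1 (gasket_eq.subset x.2)
  exact ⟨i, ⟨y, hy⟩, Subtype.ext h⟩

/-- After scaling by 2^n, `position` gives the integral coordinates of the lower left corner of a
cell. This reduces the geometry of cells to integer arithmetic. -/
theorem coordA_compose (w : List (Fin 3)) (x : gasket) :
    2 ^ w.length * coordA (HalfSystem.compose gasketMap w x : gasket) =
      coordA x + position vertexA w := by
  induction w generalizing x with
  | nil => simp [HalfSystem.compose, position]
  | cons i w ih =>
    have : coordA (gasketMap i x) = (coordA x + vertexA i) / 2 := coordA_contraction i x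
    rw [HalfSystem.compose, List.length_cons, pow_succ, mul_right_comm, ih, this, position]
    push_cast
    ring

theorem coordB_compose (w : List (Fin 3)) (x : gasket) :
    2 ^ w.length * coordB (HalfSystem.compose gasketMap w x : gasket) =
      coordB x + position vertexB w := by
  induction w generalizing x with
  | nil => simp [HalfSystem.compose, position]
  | cons i w ih =>
    have : coordB (gasketMap i x) = (coordB x + vertexB i) / 2 := coordB_contraction i x
    rw [HalfSystem.compose, List.length_cons, pow_succ, mul_right_comm, ih, this, position]
    push_cast
    ring

/-- Two cells of the same level which are equal or meet in a vertex. -/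
def Adjacent (w w' : List (Fin 3)) : Prop :=
  |position vertexA w - position vertexA w'| ≤ 1 ∧
  |position vertexB w - position vertexB w'| ≤ 1 ∧
  |(position vertexA w + position vertexB w) - (position vertexA w' + position vertexB w')| ≤ 1

theorem Adjacent.symm {w w' : List (Fin 3)} (h : Adjacent w w') : Adjacent w' w := by
  unfold Adjacent at *
  rwa [abs_sub_comm (position vertexA w'), abs_sub_comm (position vertexB w'),
    abs_sub_comm (position vertexA w' + position vertexB w')]

theorem vertex_parity : ∀ i i' : Fin 3, vertexA i % 2 = vertexA i' % 2 →
    vertexB i % 2 = vertexB i' % 2 → i = i' := by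
  decide

/-- The parities of the two coordinates determine the last letter; removing it and halving gives the
position of the parent. -/
theorem position_injective {w w' : List (Fin 3)} (h : w.length = w'.length)
    (hA : position vertexA w = position vertexA w')
    (hB : position vertexB w = position vertexB w') : w = w' := by
  induction w generalizing w' with
  | nil => exact (List.length_eq_zero_iff.1 h.symm).symm
  | cons i w ih =>
    cases w' with
    | nil => simp at h
    | cons i' w' =>
      simp only [position] at hA hB
      have hi : i = i' := vertex_parity i i' (by omega) (by omega)
      subst hi
      rw [ih (by simpa using h) (by omega) (by omega)]

open Classical in
/-- The words linked to a word of the gasket. -/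
noncomputable def gasketLink (w : List (Fin 3)) : Finset (List (Fin 3)) :=
  (words (Fin 3) w.length).filter (Adjacent w) ∪ Finset.univ.image (· :: w)

theorem mem_gasketLink {w w' : List (Fin 3)} :
    w' ∈ gasketLink w ↔ (w'.length = w.length ∧ Adjacent w w') ∨ ∃ i, w' = i :: w := by
  classical
  simp only [gasketLink, Finset.mem_union, Finset.mem_filter, mem_words, Finset.mem_image,
    Finset.mem_univ, true_and, eq_comm (a := w')]

theorem adjacent_of_mem_gasketLink {w w' : List (Fin 3)} (h : w'.length = w.length)
    (hw : w' ∈ gasketLink w) : Adjacent w w' := by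
  rcases mem_gasketLink.1 hw with h' | ⟨i, rfl⟩
  · exact h'.2
  · simp at h

/-- At most nine adjacent cells, whose offsets lie in {-1, 0, 1}², and three children. -/
theorem card_gasketLink_le (w : List (Fin 3)) : (gasketLink w).card ≤ 12 := by
  classical
  have h1 : ((words (Fin 3) w.length).filter (Adjacent w)).card ≤ 9 := by
    have hcard : (Finset.Icc (-1 : ℤ) 1 ×ˢ Finset.Icc (-1 : ℤ) 1).card = 9 := by decide
    rw [← hcard]
    refine Finset.card_le_card_of_injOn (fun v => (position vertexA w - position vertexA v,
      position vertexB w - position vertexB v)) ?_ ?_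
    · intro v hv
      have hv := (Finset.mem_filter.1 hv).2
      simp only [Finset.coe_product, Finset.coe_Icc, mem_prod, mem_Icc]
      exact ⟨abs_le.1 hv.1, abs_le.1 hv.2.1⟩
    · intro v hv v' hv' h
      simp only [Prod.mk.injEq] at h
      have hl := mem_words.1 (Finset.mem_filter.1 hv).1
      have hl' := mem_words.1 (Finset.mem_filter.1 hv').1
      exact position_injective (hl.trans hl'.symm) (by omega) (by omega)
  have h2 : (Finset.univ.image fun i : Fin 3 => i :: w).card ≤ 3 := Finset.card_image_le
  exact (Finset.card_union_le _ _).trans (by omega)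

theorem coord_mem (x : gasket) : 0 ≤ coordA x ∧ 0 ≤ coordB x ∧ coordA x + coordB x ≤ 1 :=
  coord_mem_of_mem_gasket x.2

/-- The scaled coordinates of the two points differ by at most 1/4, and the coordinates inside the
cells by at most 1. The integral positions thus differ by less than 2, hence by at most 1. -/
theorem adjacent_of_dist_lt {w w' : List (Fin 3)} {x y : gasket} (h : w.length = w'.length)
    (hd : dist (HalfSystem.compose gasketMap w x) (HalfSystem.compose gasketMap w' y) <
      (1 / 2) ^ (w.length + 3)) : Adjacent w w' := by
  set X := HalfSystem.compose gasketMap w x with hX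
  set Y := HalfSystem.compose gasketMap w' y with hY
  obtain ⟨h1, h2, h3⟩ := abs_coord_sub_le (X : Plane) (Y : Plane)
  have hxy : dist (X : Plane) Y < (1 / 2) ^ (w.length + 3) := hd
  have hp : (0 : ℝ) < 2 ^ w.length := by positivity
  have hsmall : 2 ^ w.length * (2 * dist (X : Plane) Y) ≤ 1 / 4 := by
    calc 2 ^ w.length * (2 * dist (X : Plane) Y)
        ≤ 2 ^ w.length * (2 * (1 / 2) ^ (w.length + 3)) := by gcongr
      _ = 1 / 4 := by
        rw [pow_add, one_div_pow]
        field_simp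
        norm_num
  have key : ∀ {s t : ℝ}, |s - t| ≤ 2 * dist (X : Plane) Y →
      |2 ^ w.length * s - 2 ^ w.length * t| ≤ 1 / 4 := fun {s t} hst => by
    rw [← mul_sub, abs_mul, abs_of_pos hp]
    exact (mul_le_mul_of_nonneg_left hst hp.le).trans hsmall
  have eA := coordA_compose w x
  have eB := coordB_compose w x
  have eA' := coordA_compose w' y
  have eB' := coordB_compose w' y
  rw [← h] at eA' eB'
  have k1 := key h1
  have k2 := key h2
  have k3 := key h3
  rw [mul_add, mul_add] at k3
  rw [eA, eA', abs_le] at k1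
  rw [eB, eB', abs_le] at k2
  rw [eA, eA', eB, eB', abs_le] at k3
  obtain ⟨x1, x2, x3⟩ := coord_mem x
  obtain ⟨y1, y2, y3⟩ := coord_mem y
  have int_le : ∀ {z : ℤ}, (z : ℝ) < 2 → z ≤ 1 := fun {z} hz => by
    have : z < 2 := by exact_mod_cast hz
    omega
  refine ⟨abs_le.2 ⟨?_, ?_⟩, abs_le.2 ⟨?_, ?_⟩, abs_le.2 ⟨?_, ?_⟩⟩ <;>
    first
      | (apply int_le; push_cast; linarith [k1.1, k1.2, k2.1, k2.2, k3.1, k3.2])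
      | (rw [neg_le]; apply int_le; push_cast; linarith [k1.1, k1.2, k2.1, k2.2, k3.1, k3.2])

theorem dist_gasket_le (x y : gasket) : dist x y ≤ 2 := by
  obtain ⟨x1, x2, x3⟩ := coord_mem x
  obtain ⟨y1, y2, y3⟩ := coord_mem y
  have hA : |coordA x - coordA y| ≤ 1 := abs_le.2 ⟨by linarith, by linarith⟩
  have hB : |coordB x - coordB y| ≤ 1 := abs_le.2 ⟨by linarith, by linarith⟩
  exact (dist_le_abs_coord _ _).trans (by linarith)

theorem dist_compose_lt_of_adjacent {w w' : List (Fin 3)} (x y : gasket)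
    (h : w.length = w'.length) (ha : Adjacent w w') :
    dist (HalfSystem.compose gasketMap w x) (HalfSystem.compose gasketMap w' y) <
      8 * (1 / 2) ^ w.length := by
  have hp : (0 : ℝ) < 2 ^ w.length := by positivity
  have eA := coordA_compose w x
  have eB := coordB_compose w x
  have eA' := coordA_compose w' y
  have eB' := coordB_compose w' y
  rw [← h] at eA' eB'
  obtain ⟨x1, x2, x3⟩ := coord_mem x
  obtain ⟨y1, y2, y3⟩ := coord_mem y
  obtain ⟨a1, a2, -⟩ := ha
  have a1' : |(position vertexA w : ℝ) - position vertexA w'| ≤ 1 := by exact_mod_cast a1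
  have a2' : |(position vertexB w : ℝ) - position vertexB w'| ≤ 1 := by exact_mod_cast a2
  rw [abs_le] at a1' a2'
  rw [one_div_pow, mul_one_div, lt_div_iff₀ hp, mul_comm]
  refine (mul_le_mul_of_nonneg_left (dist_le_abs_coord _ _) hp.le).trans_lt ?_
  rw [mul_add, ← abs_of_pos hp, ← abs_mul, ← abs_mul, mul_sub, mul_sub, eA, eA',
    eB, eB']
  have hA : |coordA x + position vertexA w - (coordA y + position vertexA w')| ≤ 2 :=
    abs_le.2 ⟨by linarith [a1'.1], by linarith [a1'.2]⟩
  have hB : |coordB x + position vertexB w - (coordB y + position vertexB w')| ≤ 2 :=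
    abs_le.2 ⟨by linarith [a2'.1], by linarith [a2'.2]⟩
  linarith

theorem dist_compose_gasketMap (w : List (Fin 3)) (x y : gasket) :
    dist (HalfSystem.compose gasketMap w x) (HalfSystem.compose gasketMap w y) =
      (1 / 2) ^ w.length * dist x y := by
  induction w generalizing x y with
  | nil => simp [HalfSystem.compose]
  | cons i w ih =>
    rw [HalfSystem.compose, HalfSystem.compose, ih, dist_gasketMap, List.length_cons, pow_succ]
    ring

/-- The gasket as a self-similar system. -/
noncomputable def gasketSystem : HalfSystem (Fin 3) gasket where
  map := gasketMap
  dist_map := dist_gasketMap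
  cover := gasketMap_cover
  comp := HalfSystem.compose gasketMap
  comp_nil _ := rfl
  comp_cons _ _ _ := rfl
  link := gasketLink
  bound := 12
  card_link_le := card_gasketLink_le
  cons_mem_link i w := mem_gasketLink.2 (Or.inr ⟨i, rfl⟩)
  length_le w w' h := by
    rcases mem_gasketLink.1 h with h | ⟨i, rfl⟩
    · omega
    · simp
  link_symm w w' h h' :=
    mem_gasketLink.2 (Or.inl ⟨h, (adjacent_of_mem_gasketLink h.symm h').symm⟩)
  mem_link w w' x y h h' := mem_gasketLink.2 (Or.inl ⟨h.symm, adjacent_of_dist_lt h h'⟩)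
  dist_lt_of_mem_link w w' h x y := by
    rcases mem_gasketLink.1 h with h | ⟨i, rfl⟩
    · exact dist_compose_lt_of_adjacent x y h.1.symm h.2
    · rw [HalfSystem.compose, dist_compose_gasketMap, mul_comm]
      have := dist_gasket_le x (gasketMap i y)
      have hp : (0 : ℝ) < (1 / 2) ^ w.length := by positivity
      nlinarith

/-! ### The interval as a self-similar system -/

/-- The halving maps of the interval. -/
noncomputable def intervalMap (i : Fin 2) (t : unitInterval) : unitInterval :=
  ⟨(t + (i : ℕ)) / 2, by
    have h0 := t.2.1
    have h1 := t.2.2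
    fin_cases i <;> simp <;> constructor <;> linarith⟩

theorem base_intervalMap (i : Fin 2) (t : unitInterval) :
    base (intervalMap i t) = gasketMap i.castSucc (base t) := by
  apply Subtype.ext
  ext k
  fin_cases i <;> fin_cases k <;>
    simp [base, intervalMap, gasketMap, contraction, vertex] <;> ring

theorem isometry_base : Isometry base := by
  refine Isometry.of_dist_eq fun s t => ?_
  rw [Subtype.dist_eq, EuclideanSpace.dist_eq, Fin.sum_univ_two]
  simp [base, Real.sqrt_sq_eq_abs, Subtype.dist_eq, Real.dist_eq]

theorem intervalMap_cover (t : unitInterval) : ∃ i s, intervalMap i s = t := by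
  have h0 := t.2.1
  have h1 := t.2.2
  rcases le_total (t : ℝ) (1 / 2) with h | h
  · exact ⟨0, ⟨2 * t, by constructor <;> linarith⟩, Subtype.ext (by simp [intervalMap])⟩
  · exact ⟨1, ⟨2 * t - 1, by constructor <;> linarith⟩, Subtype.ext (by simp [intervalMap])⟩

theorem base_compose (w : List (Fin 2)) (t : unitInterval) :
    base (HalfSystem.compose intervalMap w t) =
      HalfSystem.compose gasketMap (w.map Fin.castSucc) (base t) := by
  induction w generalizing t with
  | nil => rfl
  | cons i w ih => rw [HalfSystem.compose, ih, base_intervalMap, List.map_cons, HalfSystem.compose]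

/-- The interval as a self-similar system. -/
noncomputable def intervalSystem : HalfSystem (Fin 2) unitInterval :=
  gasketSystem.sub isometry_base (Fin.castSucc_injective 2) intervalMap base_intervalMap
    intervalMap_cover base_compose

theorem mem_intervalSystem_link {w w' : List (Fin 2)} : w' ∈ intervalSystem.link w ↔
    w'.map Fin.castSucc ∈ gasketSystem.link (w.map Fin.castSucc) := by
  simp only [intervalSystem, HalfSystem.sub, Finset.mem_preimage]

theorem base_mem_cell {w : List (Fin 2)} {t : unitInterval} (ht : t ∈ intervalSystem.cell w) :
    base t ∈ gasketSystem.cell (w.map Fin.castSucc) := by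
  obtain ⟨s, rfl⟩ := ht
  exact ⟨base s, (base_compose w s).symm⟩

/-- Limits of functions on words are compatible with the restriction to the interval. -/
theorem apply_base_eq_of_tracks {g : gasket → ℝ} {h : unitInterval → ℝ} {a : List (Fin 3) → ℝ}
    (hg : gasketSystem.Tracks g a)
    (hh : intervalSystem.Tracks h fun w => a (w.map Fin.castSucc)) (t : unitInterval) :
    g (base t) = h t := by
  refine eq_of_forall_dist_le fun ε hε => ?_
  obtain ⟨n, hn⟩ := hg (ε / 2) (by positivity)
  obtain ⟨m, hm⟩ := hh (ε / 2) (by positivity)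
  obtain ⟨w, hw, ht⟩ := intervalSystem.exists_mem_words_cell (max n m) t
  rw [mem_words] at hw
  have h1 := hn (w.map Fin.castSucc) (by simp [hw]) _ (base_mem_cell ht)
  have h2 := hm w (by simp [hw]) _ ht
  rw [abs_sub_comm] at h2
  rw [Real.dist_eq]
  calc _ ≤ _ := abs_sub_le _ (a (w.map Fin.castSucc)) _
    _ ≤ ε / 2 + ε / 2 := add_le_add h1 h2
    _ = ε := by ring

/-- The words of the interval and their links embed in those of the gasket, so the left side is a
partial sum of the right. This is the whole restriction estimate. -/
theorem energyAt_restrict_le (a : List (Fin 3) → ℝ) (n : ℕ) :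
    intervalSystem.energyAt (fun w => a (w.map Fin.castSucc)) n ≤ gasketSystem.energyAt a n := by
  classical
  have hinj : Function.Injective (List.map (Fin.castSucc (n := 2))) :=
    (Fin.castSucc_injective 2).list_map
  set F : List (Fin 3) → ℝ≥0∞ := fun w =>
    ∑ w' ∈ gasketSystem.link w, ENNReal.ofReal ((a w - a w') ^ 2) with hF
  calc _ ≤ ∑ w ∈ words (Fin 2) n, F (w.map Fin.castSucc) := by
        refine Finset.sum_le_sum fun w _ => ?_
        rw [← Finset.sum_image (s := intervalSystem.link w) (g := List.map Fin.castSucc)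
          (f := fun w' => ENNReal.ofReal ((a (w.map Fin.castSucc) - a w') ^ 2)) hinj.injOn]
        refine Finset.sum_le_sum_of_subset fun v hv => ?_
        obtain ⟨v, h, rfl⟩ := Finset.mem_image.1 hv
        exact mem_intervalSystem_link.1 h
    _ ≤ _ := by
        rw [← Finset.sum_image (g := List.map Fin.castSucc) (f := F) hinj.injOn]
        refine Finset.sum_le_sum_of_subset fun v hv => ?_
        obtain ⟨v, h, rfl⟩ := Finset.mem_image.1 hv
        simpa [mem_words] using h

/-! ### Extension from the base of the gasket -/

/-- The values of a harmonic function at the vertices of the subcell `i`, in terms of its values at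
the vertices of the cell. -/
noncomputable def harmonicStep (v : Fin 3 → ℝ) (i k : Fin 3) : ℝ :=
  if i = k then v i else (v 0 + v 1 + v 2 + v i + v k) / 5

/-- The energy of a function on the vertices of a cell. -/
def variation (v : Fin 3 → ℝ) : ℝ := (v 0 - v 1) ^ 2 + (v 1 - v 2) ^ 2 + (v 2 - v 0) ^ 2

theorem variation_nonneg (v : Fin 3 → ℝ) : 0 ≤ variation v := by
  unfold variation
  positivity

/-- The energy renormalization of the gasket: 3/5 is the factor against which Θ < 5/3 is played. -/
theorem sum_variation_harmonicStep (v : Fin 3 → ℝ) :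
    ∑ i, variation (harmonicStep v i) = 3 / 5 * variation v := by
  simp [Fin.sum_univ_three, variation, harmonicStep]
  ring

theorem sq_sub_le_variation (v : Fin 3 → ℝ) (i : Fin 3) : (v 0 - v i) ^ 2 ≤ variation v := by
  unfold variation
  fin_cases i <;> simp <;> nlinarith [sq_nonneg (v 0 - v 1), sq_nonneg (v 1 - v 2),
    sq_nonneg (v 2 - v 0)]

theorem sq_sub_harmonicStep_le_variation (v : Fin 3 → ℝ) (i : Fin 3) :
    (v 0 - harmonicStep v i 0) ^ 2 ≤ variation v := by
  unfold variation
  fin_cases i <;> simp [harmonicStep] <;> nlinarith [sq_nonneg (v 0 - v 1), sq_nonneg (v 1 - v 2),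
    sq_nonneg (v 2 - v 0)]

/-- The values at the vertices of the cells of the gasket of the extension of a function `b` on the
words without the letter `2`. On a cell that meets the base the value at the upper vertex is
prescribed by `b`, on the cells above the base the extension is harmonic. -/
noncomputable def extend (b : List (Fin 3) → ℝ) : List (Fin 3) → Fin 3 → ℝ
  | [], _ => b []
  | i :: w, k =>
    if 2 ∈ w then harmonicStep (extend b w) i k
    else if i = 2 then (if k = 2 then b w else b (k :: w)) else b (i :: w)

section Extend

variable {b : List (Fin 3) → ℝ}

theorem extend_of_not_mem {w : List (Fin 3)} (hw : 2 ∉ w) (k : Fin 3) : extend b w k = b w := by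
  cases w with
  | nil => rfl
  | cons i w =>
    rw [List.mem_cons, not_or] at hw
    simp [extend, hw.2, Ne.symm hw.1]

theorem position_vertexB_nonneg (w : List (Fin 3)) : 0 ≤ position vertexB w := by
  induction w with
  | nil => simp [position]
  | cons i w ih =>
    rw [position]
    have : 0 ≤ vertexB i := by fin_cases i <;> simp [vertexB]
    omega

theorem position_vertexB_eq_zero {w : List (Fin 3)} (hw : 2 ∉ w) : position vertexB w = 0 := by
  induction w with
  | nil => rfl
  | cons i w ih =>
    rw [List.mem_cons, not_or] at hw
    have : vertexB i = 0 := by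
      have := hw.1
      fin_cases i <;> simp_all [vertexB]
    rw [position, ih hw.2, this]
    rfl

theorem one_le_position_vertexB {w : List (Fin 3)} (hw : 2 ∈ w) : 1 ≤ position vertexB w := by
  induction w with
  | nil => simp at hw
  | cons i w ih =>
    rw [position]
    rcases List.mem_cons.1 hw with h | h
    · have := position_vertexB_nonneg w
      have hv : vertexB 2 = 1 := rfl
      rw [← h]
      omega
    · have : 0 ≤ vertexB i := by fin_cases i <;> simp [vertexB]
      have := ih h
      omega

theorem eq_two_of_one_le {w : List (Fin 3)} (hw : 2 ∉ w) {i : Fin 3}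
    (h : 1 ≤ position vertexB w + vertexB i) : i = 2 := by
  rw [position_vertexB_eq_zero hw] at h
  fin_cases i <;> simp_all [vertexB]

theorem extend_cons_self (w : List (Fin 3)) {i : Fin 3}
    (h : 1 ≤ position vertexB w + vertexB i) : extend b (i :: w) i = extend b w i := by
  by_cases hw : 2 ∈ w
  · simp [extend, hw, harmonicStep]
  · obtain rfl := eq_two_of_one_le hw h
    simp [extend, hw, extend_of_not_mem hw]

/-- Vertex k of child i and vertex i of child k are the same midpoint. On a base cell the midpoint
of the bottom edge is excluded: there the two children carry unrelated values. -/
theorem extend_cons_comm (w : List (Fin 3)) {i k : Fin 3} (hik : i ≠ k)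
    (h : 1 ≤ 2 * position vertexB w + vertexB i + vertexB k) :
    extend b (i :: w) k = extend b (k :: w) i := by
  by_cases hw : 2 ∈ w
  · simp [extend, hw, harmonicStep, hik, hik.symm]
    ring
  · rw [position_vertexB_eq_zero hw] at h
    fin_cases i <;> fin_cases k <;> simp_all [vertexB, extend]

/-- The parity of a vertex position tells whether it is a vertex of the parent cell (i = k) or a
midpoint, and in the latter case of which edge. -/
theorem vertex_sum_parity : ∀ i k i' k' : Fin 3,
    (vertexA i + vertexA k) % 2 = (vertexA i' + vertexA k') % 2 →
    (vertexB i + vertexB k) % 2 = (vertexB i' + vertexB k') % 2 →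
    (i = k ∧ i' = k') ∨ (i ≠ k ∧ ((i = i' ∧ k = k') ∨ (i = k' ∧ k = i'))) := by
  decide

/-- The extension is well defined at the vertices above the base. -/
theorem extend_eq_of_vertex_eq {w w' : List (Fin 3)} (hl : w.length = w'.length) {k k' : Fin 3}
    (hA : position vertexA w + vertexA k = position vertexA w' + vertexA k')
    (hB : position vertexB w + vertexB k = position vertexB w' + vertexB k')
    (h1 : 1 ≤ position vertexB w + vertexB k) : extend b w k = extend b w' k' := by
  induction w generalizing w' k k' with
  | nil =>
    obtain rfl := List.length_eq_zero_iff.1 hl.symm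
    rfl
  | cons i w ih =>
    cases w' with
    | nil => simp at hl
    | cons i' w' =>
      have hl' : w.length = w'.length := by simpa using hl
      simp only [position] at hA hB h1
      have hunique : vertexA i + vertexA k = vertexA i' + vertexA k' →
          vertexB i + vertexB k = vertexB i' + vertexB k' → w = w' := fun hA' hB' =>
        position_injective hl' (by omega) (by omega)
      -- Three cases: a vertex inherited from the parents, where induction applies; the same vertex
      -- of the same cell; or the midpoint where two children of one parent meet.
      rcases vertex_sum_parity i k i' k' (by omega) (by omega) with
        ⟨rfl, rfl⟩ | ⟨hik, ⟨rfl, rfl⟩ | ⟨rfl, rfl⟩⟩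
      · rw [extend_cons_self w (by omega), extend_cons_self w' (by omega)]
        exact ih hl' (by omega) (by omega) (by omega)
      · rw [hunique rfl rfl]
      · rw [← hunique (by omega) (by omega)]
        exact extend_cons_comm w hik (by omega)

/-- The cell itself and its six neighbours in the triangular lattice. As one of the two cells is off
the base, the common vertex can be taken above the base, where the extension is well defined. -/
theorem exists_common_vertex {w w' : List (Fin 3)} (h : Adjacent w w') (hw : 2 ∈ w ∨ 2 ∈ w') :
    ∃ k k', position vertexA w + vertexA k = position vertexA w' + vertexA k' ∧
      position vertexB w + vertexB k = position vertexB w' + vertexB k' ∧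
      1 ≤ position vertexB w + vertexB k := by
  obtain ⟨h1, h2, h3⟩ := h
  rw [abs_le] at h1 h2 h3
  have n1 := position_vertexB_nonneg w
  have n2 := position_vertexB_nonneg w'
  have hor : 1 ≤ position vertexB w ∨ 1 ≤ position vertexB w' :=
    hw.imp one_le_position_vertexB one_le_position_vertexB
  have hA : vertexA 0 = 0 ∧ vertexA 1 = 1 ∧ vertexA 2 = 0 := by simp [vertexA]
  have hB : vertexB 0 = 0 ∧ vertexB 1 = 0 ∧ vertexB 2 = 1 := by simp [vertexB]
  generalize position vertexA w = A at *
  generalize position vertexB w = B at *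
  generalize position vertexA w' = A' at *
  generalize position vertexB w' = B' at *
  have hcases : (A = A' ∧ B = B') ∨ (A + 1 = A' ∧ B = B') ∨ (A = A' + 1 ∧ B = B') ∨
      (A = A' ∧ B + 1 = B') ∨ (A = A' ∧ B = B' + 1) ∨ (A + 1 = A' ∧ B = B' + 1) ∨
      (A = A' + 1 ∧ B + 1 = B') := by omega
  rcases hcases with h | h | h | h | h | h | h
  · exact ⟨2, 2, by omega, by omega, by omega⟩
  · exact ⟨1, 0, by omega, by omega, by omega⟩
  · exact ⟨0, 1, by omega, by omega, by omega⟩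
  · exact ⟨2, 0, by omega, by omega, by omega⟩
  · exact ⟨0, 2, by omega, by omega, by omega⟩
  · exact ⟨1, 2, by omega, by omega, by omega⟩
  · exact ⟨2, 1, by omega, by omega, by omega⟩

/-- The sum of the squared differences between a word and its base children. -/
noncomputable def childVariation (b : List (Fin 3) → ℝ) (w : List (Fin 3)) : ℝ :=
  (b w - b (0 :: w)) ^ 2 + (b w - b (1 :: w)) ^ 2

theorem sum_variation_extend_of_mem {w : List (Fin 3)} (hw : 2 ∈ w) :
    ∑ i, variation (extend b (i :: w)) = 3 / 5 * variation (extend b w) := by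
  rw [← sum_variation_harmonicStep]
  refine Finset.sum_congr rfl fun i _ => ?_
  congr 1
  ext k
  simp [extend, hw]

/-- The two base children have constant vertex values, so only the upper child contributes; its
vertex values are b (0 :: w), b (1 :: w) and b w. -/
theorem sum_variation_extend_of_not_mem {w : List (Fin 3)} (hw : 2 ∉ w) :
    ∑ i, variation (extend b (i :: w)) ≤ 3 * childVariation b w := by
  simp [Fin.sum_univ_three, variation, extend, hw, childVariation]
  nlinarith [sq_nonneg ((b w - b (0 :: w)) + (b w - b (1 :: w)))]

theorem sum_variation_extend_le (w : List (Fin 3)) :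
    ∑ i, variation (extend b (i :: w)) ≤
      3 / 5 * variation (extend b w) + 3 * (if 2 ∈ w then 0 else childVariation b w) := by
  by_cases hw : 2 ∈ w
  · simp [sum_variation_extend_of_mem hw, hw]
  · have := variation_nonneg (extend b w)
    simp only [hw, if_false]
    linarith [sum_variation_extend_of_not_mem (b := b) hw]

/-- Adjacent cells not both on the base are compared through a common vertex, which yields the two
variations. Adjacent base cells give a difference of b, and a child is compared with its parent by
the harmonic rule or by the data on the base. -/
theorem sq_sub_extend_le {w w' : List (Fin 3)} (h : w' ∈ gasketLink w) :
    (extend b w 0 - extend b w' 0) ^ 2 ≤ 2 * variation (extend b w) +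
      (if w'.length = w.length then 2 * variation (extend b w') else 0) +
      (if 2 ∈ w then 0 else childVariation b w) +
      (if 2 ∉ w ∧ 2 ∉ w' then (b w - b w') ^ 2 else 0) := by
  have v1 := variation_nonneg (extend b w)
  have v2 := variation_nonneg (extend b w')
  have hc : 0 ≤ childVariation b w := by
    unfold childVariation
    positivity
  have hn1 : 0 ≤ if w'.length = w.length then 2 * variation (extend b w') else 0 := by
    split_ifs <;> linarith
  have hn2 : 0 ≤ if 2 ∈ w then 0 else childVariation b w := by
    split_ifs <;> linarith
  have hn3 : 0 ≤ if 2 ∉ w ∧ 2 ∉ w' then (b w - b w') ^ 2 else 0 := by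
    split_ifs <;> positivity
  rcases mem_gasketLink.1 h with ⟨hl, ha⟩ | ⟨i, rfl⟩
  · by_cases hw : 2 ∉ w ∧ 2 ∉ w'
    · rw [extend_of_not_mem hw.1, extend_of_not_mem hw.2, if_pos hw]
      linarith
    · obtain ⟨k, k', hA, hB, h1⟩ := exists_common_vertex ha (by tauto)
      have e := extend_eq_of_vertex_eq (b := b) hl.symm hA hB h1
      have q1 := sq_sub_le_variation (extend b w) k
      have q2 := sq_sub_le_variation (extend b w') k'
      rw [if_pos hl] at hn1 ⊢
      rw [← e] at q2
      nlinarith [sq_nonneg ((extend b w 0 - extend b w k) + (extend b w' 0 - extend b w k))]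
  · by_cases hw : 2 ∈ w
    · have e : extend b (i :: w) 0 = harmonicStep (extend b w) i 0 := by simp [extend, hw]
      rw [e]
      linarith [sq_sub_harmonicStep_le_variation (extend b w) i]
    · have hle : (extend b w 0 - extend b (i :: w) 0) ^ 2 ≤ childVariation b w := by
        have s0 := sq_nonneg (b w - b (0 :: w))
        have s1 := sq_nonneg (b w - b (1 :: w))
        rw [extend_of_not_mem hw, childVariation]
        fin_cases i <;> simp [extend, hw] <;> linarith
      rw [if_neg hw] at hn2 ⊢
      linarith

end Extend

/-! ### Energy of the extension -/

/-- The forward counterpart of the earlier recursion. Bounding partial sums by induction avoids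
subtracting a sum that could be infinite. -/
theorem tsum_lt_top_of_succ_le {κ : ℝ≥0∞} (hκ : κ < 1) {Y E : ℕ → ℝ≥0∞} (h0 : Y 0 < ∞)
    (h : ∀ n, Y (n + 1) ≤ κ * Y n + E n) (hE : ∑' n, E n < ∞) : ∑' n, Y n < ∞ := by
  set T := Y 0 + ∑' n, E n with hT
  have hpos : 1 - κ ≠ 0 := (tsub_pos_of_lt hκ).ne'
  have hgeom : 1 + κ * (1 - κ)⁻¹ = (1 - κ)⁻¹ := by
    have h1 : (1 - κ) * (1 - κ)⁻¹ = 1 :=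
      ENNReal.mul_inv_cancel hpos (ENNReal.sub_ne_top ENNReal.one_ne_top)
    nth_rewrite 1 [← h1]
    rw [← add_mul, tsub_add_cancel_of_le hκ.le, one_mul]
  have hsum : ∀ N, ∑ n ∈ Finset.range N, Y n ≤ T * (1 - κ)⁻¹ := by
    intro N
    induction N with
    | zero => simp
    | succ N ih =>
      rw [Finset.sum_range_succ']
      calc ∑ n ∈ Finset.range N, Y (n + 1) + Y 0
          ≤ ∑ n ∈ Finset.range N, (κ * Y n + E n) + Y 0 := by
            gcongr with n
            exact h n
        _ ≤ κ * (T * (1 - κ)⁻¹) + ∑' n, E n + Y 0 := by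
            rw [Finset.sum_add_distrib, ← Finset.mul_sum]
            gcongr
            exact ENNReal.sum_le_tsum _
        _ = T * (1 + κ * (1 - κ)⁻¹) := by
            rw [hT]
            ring
        _ = _ := by rw [hgeom]
  exact (ENNReal.tsum_le_of_sum_range_le hsum).trans_lt (ENNReal.mul_lt_top
    (ENNReal.add_lt_top.2 ⟨h0, hE⟩) (ENNReal.inv_lt_top.2 (tsub_pos_of_lt hκ)))

theorem exists_map_castSucc {w : List (Fin 3)} (hw : 2 ∉ w) :
    ∃ v : List (Fin 2), v.map Fin.castSucc = w := by
  induction w with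
  | nil => exact ⟨[], rfl⟩
  | cons i w ih =>
    rw [List.mem_cons, not_or] at hw
    obtain ⟨v, rfl⟩ := ih hw.2
    obtain ⟨j, rfl⟩ : ∃ j : Fin 2, j.castSucc = i := by
      have := hw.1
      fin_cases i
      · exact ⟨0, rfl⟩
      · exact ⟨1, rfl⟩
      · simp at this
    exact ⟨j :: v, rfl⟩

theorem two_not_mem_map_castSucc (v : List (Fin 2)) : 2 ∉ v.map Fin.castSucc := by
  intro h
  obtain ⟨j, -, hj⟩ := List.mem_map.1 h
  fin_cases j <;> simp at hj

theorem map_castSucc_injective : Function.Injective (List.map (Fin.castSucc (n := 2))) :=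
  (Fin.castSucc_injective 2).list_map

theorem sum_words_base (n : ℕ) (F : List (Fin 3) → ℝ≥0∞) :
    ∑ w ∈ words (Fin 3) n, (if 2 ∈ w then 0 else F w) =
      ∑ v ∈ words (Fin 2) n, F (v.map Fin.castSucc) := by
  classical
  rw [← Finset.sum_image (g := List.map Fin.castSucc) (f := F) map_castSucc_injective.injOn]
  have e : ∀ w : List (Fin 3), (if 2 ∈ w then 0 else F w) = if 2 ∉ w then F w else 0 :=
    fun w => by by_cases hw : 2 ∈ w <;> simp [hw]
  simp_rw [e]
  rw [← Finset.sum_filter]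
  refine Finset.sum_congr (Finset.ext fun w => ?_) fun _ _ => rfl
  simp only [Finset.mem_filter, Finset.mem_image, mem_words]
  constructor
  · rintro ⟨hl, hw⟩
    obtain ⟨v, rfl⟩ := exists_map_castSucc hw
    exact ⟨v, by simpa using hl, rfl⟩
  · rintro ⟨v, hv, rfl⟩
    exact ⟨by simpa using hv, two_not_mem_map_castSucc v⟩

section ExtensionEnergy

variable {b : List (Fin 3) → ℝ}

theorem sum_childVariation_le (n : ℕ) :
    ∑ w ∈ words (Fin 3) n, (if 2 ∈ w then 0 else ENNReal.ofReal (childVariation b w)) ≤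
      intervalSystem.energyAt (fun v => b (v.map Fin.castSucc)) n := by
  rw [sum_words_base]
  refine Finset.sum_le_sum fun v _ => ?_
  refine le_trans (le_of_eq ?_) (intervalSystem.sum_children_le_sum_link v fun v' =>
    ENNReal.ofReal ((b (v.map Fin.castSucc) - b (v'.map Fin.castSucc)) ^ 2))
  rw [Fin.sum_univ_two, childVariation, ENNReal.ofReal_add (by positivity) (by positivity)]
  rfl

theorem sum_base_link_le (n : ℕ) :
    ∑ w ∈ words (Fin 3) n, ∑ w' ∈ gasketLink w,
      (if 2 ∉ w ∧ 2 ∉ w' then ENNReal.ofReal ((b w - b w') ^ 2) else 0) ≤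
      intervalSystem.energyAt (fun v => b (v.map Fin.castSucc)) n := by
  classical
  have e : ∀ w, ∑ w' ∈ gasketLink w,
      (if 2 ∉ w ∧ 2 ∉ w' then ENNReal.ofReal ((b w - b w') ^ 2) else 0) =
      if 2 ∈ w then 0 else ∑ w' ∈ gasketLink w,
        (if 2 ∉ w' then ENNReal.ofReal ((b w - b w') ^ 2) else 0) := fun w => by
    by_cases hw : 2 ∈ w <;> simp [hw]
  simp_rw [e]
  rw [sum_words_base]
  refine Finset.sum_le_sum fun v _ => ?_
  rw [← Finset.sum_filter, ← Finset.sum_image (s := intervalSystem.link v)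
    (g := List.map Fin.castSucc) (f := fun w' =>
      ENNReal.ofReal ((b (v.map Fin.castSucc) - b w') ^ 2)) map_castSucc_injective.injOn]
  refine Finset.sum_le_sum_of_subset fun w' hw' => ?_
  obtain ⟨h1, h2⟩ := Finset.mem_filter.1 hw'
  obtain ⟨v', rfl⟩ := exists_map_castSucc h2
  exact Finset.mem_image_of_mem _ (mem_intervalSystem_link.2 h1)

/-- The energy of the extension on the vertices of the cells of level `n`. -/
noncomputable def variationAt (b : List (Fin 3) → ℝ) (n : ℕ) : ℝ≥0∞ :=
  ∑ w ∈ words (Fin 3) n, ENNReal.ofReal (variation (extend b w))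

/-- Cells above the base decay by 3/5, while the cells along the base feed in new energy controlled
by the interval. -/
theorem variationAt_succ_le (n : ℕ) :
    variationAt b (n + 1) ≤ ENNReal.ofReal (3 / 5) * variationAt b n +
      3 * intervalSystem.energyAt (fun v => b (v.map Fin.castSucc)) n := by
  rw [variationAt, sum_words_succ]
  calc ∑ w ∈ words (Fin 3) n, ∑ i, ENNReal.ofReal (variation (extend b (i :: w)))
      ≤ ∑ w ∈ words (Fin 3) n, (ENNReal.ofReal (3 / 5) * ENNReal.ofReal (variation (extend b w)) +
          3 * (if 2 ∈ w then 0 else ENNReal.ofReal (childVariation b w))) := by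
        refine Finset.sum_le_sum fun w _ => ?_
        rw [← ENNReal.ofReal_sum_of_nonneg fun i _ => variation_nonneg _]
        refine (ENNReal.ofReal_le_ofReal (sum_variation_extend_le w)).trans ?_
        refine ENNReal.ofReal_add_le.trans_eq ?_
        rw [ENNReal.ofReal_mul (by norm_num), ENNReal.ofReal_mul (by norm_num),
          ENNReal.ofReal_ofNat, apply_ite ENNReal.ofReal, ENNReal.ofReal_zero]
    _ ≤ _ := by
        rw [Finset.sum_add_distrib, ← Finset.mul_sum, ← Finset.mul_sum, variationAt]
        gcongr
        exact sum_childVariation_le n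

theorem sum_link_variation_le (n : ℕ) :
    ∑ w ∈ words (Fin 3) n, ∑ w' ∈ gasketLink w,
      (if w'.length = w.length then 2 * ENNReal.ofReal (variation (extend b w')) else 0) ≤
      24 * variationAt b n := by
  classical
  have e : ∀ w, ∑ w' ∈ gasketLink w,
      (if w'.length = w.length then 2 * ENNReal.ofReal (variation (extend b w')) else 0) =
      ∑ w' ∈ (gasketLink w).filter (fun w' => w'.length = w.length),
        2 * ENNReal.ofReal (variation (extend b w')) := fun w => by rw [Finset.sum_filter]
  simp_rw [e]
  rw [Finset.sum_comm' (t' := words (Fin 3) n)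
    (s' := fun w => (gasketLink w).filter (fun w' => w'.length = w.length)), variationAt,
    Finset.mul_sum]
  · refine Finset.sum_le_sum fun w _ => ?_
    rw [Finset.sum_const, nsmul_eq_mul, ← mul_assoc]
    refine mul_le_mul' ?_ le_rfl
    have h12 : (((gasketLink w).filter (fun w' => w'.length = w.length)).card : ℝ≥0∞) ≤ 12 := by
      exact_mod_cast (Finset.card_filter_le _ _).trans (card_gasketLink_le w)
    calc _ ≤ (12 : ℝ≥0∞) * 2 := by gcongr
      _ = 24 := by norm_num
  · intro w w'
    simp only [Finset.mem_filter, mem_words]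
    constructor
    · rintro ⟨h1, h2, h3⟩
      exact ⟨⟨gasketSystem.link_symm _ _ h3.symm h2, h3.symm⟩, h3.trans h1⟩
    · rintro ⟨⟨h2, h3⟩, h1⟩
      exact ⟨h3.trans h1, gasketSystem.link_symm _ _ h3.symm h2, h3.symm⟩

theorem energyAt_extend_le (n : ℕ) :
    gasketSystem.energyAt (fun w => extend b w 0) n ≤ 48 * variationAt b n +
      13 * intervalSystem.energyAt (fun v => b (v.map Fin.castSucc)) n := by
  have h12 : ∀ w, ((gasketLink w).card : ℝ≥0∞) ≤ 12 := fun w => by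
    exact_mod_cast card_gasketLink_le w
  calc gasketSystem.energyAt (fun w => extend b w 0) n
      ≤ ∑ w ∈ words (Fin 3) n, ∑ w' ∈ gasketLink w,
          (2 * ENNReal.ofReal (variation (extend b w)) +
          (if w'.length = w.length then 2 * ENNReal.ofReal (variation (extend b w')) else 0) +
          (if 2 ∈ w then 0 else ENNReal.ofReal (childVariation b w)) +
          (if 2 ∉ w ∧ 2 ∉ w' then ENNReal.ofReal ((b w - b w') ^ 2) else 0)) := by
        refine Finset.sum_le_sum fun w _ => Finset.sum_le_sum fun w' hw' => ?_
        refine (ENNReal.ofReal_le_ofReal (sq_sub_extend_le hw')).trans ?_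
        refine ENNReal.ofReal_add_le.trans (add_le_add (ENNReal.ofReal_add_le.trans
          (add_le_add (ENNReal.ofReal_add_le.trans (add_le_add ?_ ?_)) ?_)) ?_)
        · rw [ENNReal.ofReal_mul two_pos.le, ENNReal.ofReal_ofNat]
        · rw [apply_ite ENNReal.ofReal, ENNReal.ofReal_mul two_pos.le, ENNReal.ofReal_ofNat,
            ENNReal.ofReal_zero]
        · rw [apply_ite ENNReal.ofReal, ENNReal.ofReal_zero]
        · rw [apply_ite ENNReal.ofReal, ENNReal.ofReal_zero]
    -- Each word has at most 12 links, with a factor 2 for the variation at either end; the terms on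
    -- pairs of base words are counted once.
    _ ≤ 24 * variationAt b n + 24 * variationAt b n +
          12 * intervalSystem.energyAt (fun v => b (v.map Fin.castSucc)) n +
          intervalSystem.energyAt (fun v => b (v.map Fin.castSucc)) n := by
        simp_rw [Finset.sum_add_distrib]
        refine add_le_add (add_le_add (add_le_add ?_ (sum_link_variation_le n)) ?_)
          (sum_base_link_le n)
        · rw [variationAt, Finset.mul_sum]
          refine Finset.sum_le_sum fun w _ => ?_
          rw [Finset.sum_const, nsmul_eq_mul, ← mul_assoc]
          refine mul_le_mul' ?_ le_rfl
          calc _ ≤ (12 : ℝ≥0∞) * 2 := by gcongr; exact h12 w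
            _ = 24 := by norm_num
        · refine le_trans ?_ (mul_le_mul' le_rfl (sum_childVariation_le n))
          rw [Finset.mul_sum]
          refine Finset.sum_le_sum fun w _ => ?_
          rw [Finset.sum_const, nsmul_eq_mul]
          exact mul_le_mul' (h12 w) le_rfl
    _ = _ := by ring

/-- The weighted variations satisfy a forward recursion with factor (3/5)Θ < 1 and a source given by
the energy on the interval. This is the only place where the upper bound on Θ enters. -/
theorem energy_extend_lt_top {Θ : ℝ} (hΘ : Θ < 5 / 3)
    (hb : intervalSystem.energy Θ (fun v => b (v.map Fin.castSucc)) < ∞) :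
    gasketSystem.energy Θ (fun w => extend b w 0) < ∞ := by
  have hV : ∑' n, ENNReal.ofReal Θ ^ n * variationAt b n < ∞ := by
    refine tsum_lt_top_of_succ_le (κ := ENNReal.ofReal (3 / 5 * Θ))
      (E := fun n => (ENNReal.ofReal Θ * 3) * (ENNReal.ofReal Θ ^ n *
        intervalSystem.energyAt (fun v => b (v.map Fin.castSucc)) n)) ?_ ?_ (fun n => ?_) ?_
    · rw [ENNReal.ofReal_lt_one]
      linarith
    · simp [variationAt, words]
    · refine (mul_le_mul' le_rfl (variationAt_succ_le n)).trans_eq ?_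
      rw [ENNReal.ofReal_mul (by norm_num)]
      ring
    · rw [ENNReal.tsum_mul_left]
      exact ENNReal.mul_lt_top (ENNReal.mul_lt_top ENNReal.ofReal_lt_top (by simp)) hb
  refine (ENNReal.tsum_le_tsum (g := fun n => 48 * (ENNReal.ofReal Θ ^ n * variationAt b n) +
    13 * (ENNReal.ofReal Θ ^ n *
      intervalSystem.energyAt (fun v => b (v.map Fin.castSucc)) n)) fun n => ?_).trans_lt ?_
  · refine (mul_le_mul' le_rfl (energyAt_extend_le n)).trans_eq ?_
    ring
  · rw [ENNReal.tsum_add, ENNReal.tsum_mul_left, ENNReal.tsum_mul_left]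
    exact ENNReal.add_lt_top.2 ⟨ENNReal.mul_lt_top (by simp) hV, ENNReal.mul_lt_top (by simp) hb⟩

end ExtensionEnergy

/-! ### Continuous versions and traces -/

namespace HalfSystem

variable {ι : Type} [Fintype ι] {M : Type} [MetricSpace M] (S : HalfSystem ι M)
  [MeasurableSpace M]

theorem isOpenPosMeasure_of_cell [Nonempty M] {μ : Measure M}
    (hμ : ∀ w, μ (S.cell w) = ((Fintype.card ι : ℝ≥0∞)⁻¹) ^ w.length) :
    μ.IsOpenPosMeasure := by
  refine ⟨fun U hU ⟨x, hx⟩ => ?_⟩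
  obtain ⟨ε, hε, hball⟩ := Metric.isOpen_iff.1 hU x hx
  have hlim : Tendsto (fun n : ℕ => (8 : ℝ) * (1 / 2) ^ n) atTop (nhds 0) := by
    simpa using (tendsto_pow_atTop_nhds_zero_of_lt_one (r := (1 / 2 : ℝ))
      (by norm_num) (by norm_num)).const_mul 8
  obtain ⟨n, hn⟩ := (hlim.eventually_lt_const hε).exists
  obtain ⟨w, hw, hxw⟩ := S.exists_mem_words_cell n x
  have hsub : S.cell w ⊆ U := fun y hy => hball (by
    have := S.dist_lt_of_mem_cell (S.mem_link_of_mem_cell_inter rfl hxw hxw) hy hxw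
    rw [mem_words.1 hw] at this
    exact this.trans hn)
  refine (lt_of_lt_of_le ?_ (measure_mono hsub)).ne'
  rw [hμ]
  exact ENNReal.pow_pos (ENNReal.inv_pos.2 (ENNReal.natCast_ne_top _)) _

variable [BorelSpace M] [CompactSpace M] [Nonempty M] {d β : ℝ}

/-- Above the dimension, functions in the Besov space have a continuous version, which is the
limit of the cell averages. -/
theorem exists_continuous_version (hd : (2 : ℝ) ^ d = Fintype.card ι) (hN : 2 ≤ Fintype.card ι)
    (hβ : d < β) {u : Lp ℝ 2 (normalizedHausdorff M d)}
    (hu : u ∈ besov (normalizedHausdorff M d) d β) :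
    ∃ g : C(M, ℝ), u =ᵐ[normalizedHausdorff M d] g ∧
      S.Tracks g (S.cellAverage (normalizedHausdorff M d) u) := by
  have := S.isProbabilityMeasure_normalizedHausdorff hd hN
  have hμ := S.normalizedHausdorff_cell hd hN
  have hΘ : (1 : ℝ) < 2 ^ (β - d) := Real.one_lt_rpow one_lt_two (by linarith)
  obtain ⟨g, C, -, hg⟩ := S.exists_continuous_abs_sub_le hΘ
    (S.energy_cellAverage_lt_top hd hμ hN hu)
  have ht := S.tracks_of_abs_sub_le hΘ hg
  exact ⟨g, S.ae_eq_of_tracks_cellAverage hd hμ hN hβ hu ht, ht⟩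

/-- Every function of finite energy on words converges to a function in the Besov space. -/
theorem exists_mem_besov (hd : (2 : ℝ) ^ d = Fintype.card ι) (hN : 2 ≤ Fintype.card ι)
    (hβ : d < β) {a : List ι → ℝ} (ha : S.energy (2 ^ (β - d)) a < ∞) :
    ∃ g : C(M, ℝ), S.Tracks g a ∧ ∀ u : Lp ℝ 2 (normalizedHausdorff M d),
      u =ᵐ[normalizedHausdorff M d] g → u ∈ besov (normalizedHausdorff M d) d β := by
  have := S.isProbabilityMeasure_normalizedHausdorff hd hN
  have hμ := S.normalizedHausdorff_cell hd hN
  have hΘ : (1 : ℝ) < 2 ^ (β - d) := Real.one_lt_rpow one_lt_two (by linarith)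
  obtain ⟨g, C, -, hg⟩ := S.exists_continuous_abs_sub_le hΘ ha
  exact ⟨g, S.tracks_of_abs_sub_le hΘ hg, fun u hu =>
    S.mem_besov_of_energy_lt_top hd hμ hN hβ ha hg hu⟩

theorem continuousMap_eq_of_ae_eq (S : HalfSystem ι M) (hd : (2 : ℝ) ^ d = Fintype.card ι)
    (hN : 2 ≤ Fintype.card ι) {g h : C(M, ℝ)} (hgh : g =ᵐ[normalizedHausdorff M d] h) : g = h := by
  have := S.isOpenPosMeasure_of_cell (S.normalizedHausdorff_cell hd hN)
  exact DFunLike.coe_injective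
    ((Continuous.ae_eq_iff_eq _ g.continuous h.continuous).1 hgh)

end HalfSystem

/-! ### The two inclusions for the trace space -/

instance : CompactSpace gasket := isCompact_iff_compactSpace.1 isCompact_gasket

instance : Nonempty gasket := ⟨⟨_, vertex_mem_gasket 0⟩⟩

theorem two_rpow_dimGasket : (2 : ℝ) ^ dimGasket = Fintype.card (Fin 3) := by
  rw [dimGasket, Real.rpow_def_of_pos two_pos, mul_div_cancel₀ _ (Real.log_pos one_lt_two).ne',
    Real.exp_log (by norm_num)]
  simp

/-- At β = β₁* the exponent is log (5/3) / log 2, so the walk dimension is exactly the threshold Θ =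
5/3. -/
theorem two_rpow_sub_lt {β : ℝ} (hβ : β < walkDimGasket) :
    (2 : ℝ) ^ (β - dimGasket) < 5 / 3 := by
  have h2 : (0 : ℝ) < Real.log 2 := Real.log_pos one_lt_two
  have h : (2 : ℝ) ^ (walkDimGasket - dimGasket) = 5 / 3 := by
    rw [walkDimGasket, dimGasket, ← sub_div, ← Real.log_div (by norm_num) (by norm_num),
      Real.rpow_def_of_pos two_pos, mul_div_cancel₀ _ h2.ne', Real.exp_log (by norm_num)]
  rw [← h]
  exact Real.rpow_lt_rpow_of_exponent_lt one_lt_two (by linarith)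

theorem two_rpow_one : (2 : ℝ) ^ (1 : ℝ) = Fintype.card (Fin 2) := by
  simp

theorem traceSpace_besov_subset {β₁ β₂ : ℝ} (h₁ : dimGasket < β₁)
    (hβ : β₁ - dimGasket = β₂ - 1) :
    traceSpace (besov gasketMeasure dimGasket β₁) ⊆ besov intervalMeasure 1 β₂ := by
  rintro v ⟨u, hu, g, hug, hvg⟩
  obtain ⟨g', hug', ht⟩ := gasketSystem.exists_continuous_version two_rpow_dimGasket (by simp) h₁ hu
  -- The given continuous version must be the one that is the limit of the cell averages.
  obtain rfl : g = g' := gasketSystem.continuousMap_eq_of_ae_eq two_rpow_dimGasket (by simp)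
    (hug.symm.trans hug')
  have hp := gasketSystem.isProbabilityMeasure_normalizedHausdorff two_rpow_dimGasket (by simp)
  have hE := gasketSystem.energy_cellAverage_lt_top two_rpow_dimGasket
    (gasketSystem.normalizedHausdorff_cell two_rpow_dimGasket (by simp)) (by simp) hu
  set a := gasketSystem.cellAverage (normalizedHausdorff gasket dimGasket) u
  -- These are averages over gasket cells, not over subintervals. That is harmless, since any
  -- function of finite energy on words has a limit in the Besov space.
  have hE' : intervalSystem.energy (2 ^ (β₂ - 1)) (fun w => a (w.map Fin.castSucc)) < ∞ := by
    rw [← hβ]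
    exact (ENNReal.tsum_le_tsum fun n =>
      mul_le_mul' le_rfl (energyAt_restrict_le a n)).trans_lt hE
  obtain ⟨h, hh, hmem⟩ := intervalSystem.exists_mem_besov two_rpow_one (by simp)
    (by linarith) hE'
  refine hmem v (hvg.trans (Eventually.of_forall fun t => ?_))
  exact apply_base_eq_of_tracks ht hh t

theorem besov_subset_traceSpace {β₁ β₂ : ℝ} (h₁ : dimGasket < β₁) (h₂ : β₁ < walkDimGasket)
    (hβ : β₁ - dimGasket = β₂ - 1) :
    besov intervalMeasure 1 β₂ ⊆ traceSpace (besov gasketMeasure dimGasket β₁) := by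
  intro v hv
  have hp : IsProbabilityMeasure gasketMeasure :=
    gasketSystem.isProbabilityMeasure_normalizedHausdorff two_rpow_dimGasket (by simp)
  have hp' := intervalSystem.isProbabilityMeasure_normalizedHausdorff two_rpow_one (by simp)
  obtain ⟨h, hvh, ht⟩ := intervalSystem.exists_continuous_version two_rpow_one (by simp)
    (by linarith) hv
  have hE := intervalSystem.energy_cellAverage_lt_top two_rpow_one
    (intervalSystem.normalizedHausdorff_cell two_rpow_one (by simp)) (by simp) hv
  set a := intervalSystem.cellAverage (normalizedHausdorff unitInterval 1) v
  -- The default value 0 plays no role: `extend` evaluates b only at words without the letter 2.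
  set b : List (Fin 3) → ℝ := Function.extend (List.map Fin.castSucc) a 0
  have hb : (fun w : List (Fin 2) => b (w.map Fin.castSucc)) = a :=
    funext fun w => map_castSucc_injective.extend_apply _ _ w
  have hE' : gasketSystem.energy (2 ^ (β₁ - dimGasket)) (fun w => extend b w 0) < ∞ := by
    refine energy_extend_lt_top (two_rpow_sub_lt h₂) ?_
    rwa [hb, hβ]
  obtain ⟨g, hg, hmem⟩ := gasketSystem.exists_mem_besov two_rpow_dimGasket (by simp) h₁ hE'
  have hu := ContinuousMap.coeFn_toLp (p := 2) (𝕜 := ℝ) gasketMeasure g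
  refine ⟨ContinuousMap.toLp 2 gasketMeasure ℝ g, hmem _ hu, g, hu,
    hvh.trans (Eventually.of_forall fun t => (apply_base_eq_of_tracks hg ?_ t).symm)⟩
  -- On base words the extension returns the original averages, so the trace of its limit is the
  -- continuous version of v.
  have e : (fun w : List (Fin 2) => extend b (w.map Fin.castSucc) 0) = a := by
    rw [← hb]
    exact funext fun w => extend_of_not_mem (two_not_mem_map_castSucc w) 0
  rwa [e]

end SierpinskiTrace

theorem mainTheorem5 (β₁ β₂ : ℝ)
    (hβ₁ : β₁ ∈ Set.Ioo SierpinskiTrace.dimGasket SierpinskiTrace.walkDimGasket)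
    (hβ : β₁ - SierpinskiTrace.dimGasket = β₂ - 1) :
    (∀ u ∈ SierpinskiTrace.besov SierpinskiTrace.gasketMeasure SierpinskiTrace.dimGasket β₁,
      ∃! g : C(SierpinskiTrace.gasket, ℝ), u =ᵐ[SierpinskiTrace.gasketMeasure] g) ∧
    SierpinskiTrace.traceSpace
        (SierpinskiTrace.besov SierpinskiTrace.gasketMeasure SierpinskiTrace.dimGasket β₁) =
      SierpinskiTrace.besov SierpinskiTrace.intervalMeasure 1 β₂ := by
  have h2 : 2 ≤ Fintype.card (Fin 3) := by simp
  refine ⟨fun u hu => ?_, Set.Subset.antisymm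
    (SierpinskiTrace.traceSpace_besov_subset hβ₁.1 hβ)
    (SierpinskiTrace.besov_subset_traceSpace hβ₁.1 hβ₁.2 hβ)⟩
  obtain ⟨g, hg, -⟩ := SierpinskiTrace.gasketSystem.exists_continuous_version
    SierpinskiTrace.two_rpow_dimGasket h2 hβ₁.1 hu
  exact ⟨g, hg, fun g' hg' => SierpinskiTrace.gasketSystem.continuousMap_eq_of_ae_eq
    SierpinskiTrace.two_rpow_dimGasket h2 (hg'.symm.trans hg)⟩
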